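/- For $\nu\in\mathbb C$ and $-1<x\le 1$ let $P_\nu(x)={}_2F_1\!\left(-\nu,\nu+1;1;\tfrac{1-x}{2}\right)$ be the Legendre function of the first kind. For $-1<x<1$ let $$Q_\nu(x)=\frac{\pi}{2\sin(\nu\pi)}\bigl[\cos(\nu\pi)P_\nu(x)-P_\nu(-x)\bigr]\quad(\nu\in\mathbb C\smallsetminus\mathbb Z),\qquad Q_n(x)=\lim_{\nu\to n}Q_\nu(x)\quad(n\in\mathbb Z_{\ge 0})$$ be the Legendre functions of the second kind. For $-1<x<1$ write $\mathcal P\int_{-1}^1 f(\xi)\,d\xi=\lim_{\varepsilon\to0^+}\int_{(-1,1)\smallsetminus[x-\varepsilon,x+\varepsilon]}f(\xi)\,d\xi$ for the Cauchy principal value at $\xi=x$. **Proposition (Tricomi transform of $P_\nu(\xi)P_\nu(-\xi)$).** For every $\nu\in\mathbb C\smallsetminus\mathbb Z$ and $-1<x<1$, $$\mathcal P\int_{-1}^1\frac{2P_\nu(\xi)P_\nu(-\xi)}{\pi(x-\xi)}\,d\xi=\frac{[P_\nu(x)]^2-[P_\nu(-x)]^2}{\sin(\nu\pi)}.$$ For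 every integer $n\ge 0$ and $-1<x<1$, $$\mathcal P\int_{-1}^1\frac{[P_n(\xi)]^2}{2(x-\xi)}\,d\xi=\mathcal P\int_{-1}^1\frac{[P_{-n-1}(\xi)]^2}{2(x-\xi)}\,d\xi=P_n(x)\,Q_n(x).$$ In particular all principal values above, and the limit defining $Q_n(x)$, exist. -/

import Mathlib

/-- The Legendre function of the first kind `P_ν(x)` of complex degree `ν`, for `-1 < x ≤ 1`:
the Gauss hypergeometric series `₂F₁(-ν, ν + 1; 1; (1 - x) / 2)`. -/
noncomputable def legendreP (ν : ℂ) (x : ℝ) : ℂ :=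
  ordinaryHypergeometric (-ν) (ν + 1) (1 : ℂ) ((1 - (x : ℂ)) / 2)

/-- The Legendre function of the second kind `Q_ν(x)` of non-integer degree `ν`,
for `-1 < x < 1`. -/
noncomputable def legendreQ (ν : ℂ) (x : ℝ) : ℂ :=
  (Real.pi : ℂ) / (2 * Complex.sin (ν * Real.pi)) *
    (Complex.cos (ν * Real.pi) * legendreP ν x - legendreP ν (-x))

/-- The Legendre function of the second kind `Q_n(x)` of degree `n = 0, 1, 2, …`,
for `-1 < x < 1`: the limit of `Q_ν(x)` as `ν → n`, `ν ≠ n`. -/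
noncomputable def legendreQNat (n : ℕ) (x : ℝ) : ℂ :=
  Filter.limUnder (nhdsWithin (n : ℂ) {(n : ℂ)}ᶜ) (fun ν : ℂ => legendreQ ν x)

/-- The Cauchy principal value of `∫_a^b f(ξ) dξ` with respect to the point `c` exists and
equals `I`: off every symmetric neighbourhood of `c` the function `f` is Lebesgue integrable, and
the integrals over `(a, b) ∖ [c - ε, c + ε]` tend to `I` as `ε → 0⁺`. -/
def HasPrincipalValue (f : ℝ → ℂ) (a b c : ℝ) (I : ℂ) : Prop :=
  (∀ ε : ℝ, 0 < ε →
    MeasureTheory.IntegrableOn f (Set.Ioo a b \ Set.Icc (c - ε) (c + ε))) ∧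
  Filter.Tendsto (fun ε : ℝ => ∫ ξ in Set.Ioo a b \ Set.Icc (c - ε) (c + ε), f ξ)
    (nhdsWithin 0 (Set.Ioi 0)) (nhds I)

open Filter Topology MeasureTheory Set

/-! Write u = P_ν(z), v = P_ν(-z), w = uv, and let G(z) be the Cauchy transform ∫ w(ξ)/(z-ξ) dξ over
(-1, 1), for z in the upper half plane. Legendre's equation is a first-order system for a solution
and its flux (1-z²)d/dz. Its symmetric square is a closed system for w, the flux of w, and the
product of the fluxes of u and v. Integration by parts against the Cauchy kernel shows that G
satisfies the same system: the terms produced by the total mass of w are absorbed by adding it to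
the transform of the second component and subtracting ν(ν+1)z times it from the transform of the
third.

The symmetric square carries an invariant bilinear form, so pairing the solution built from G with
u², v² and uv gives three quantities that are constant on the upper half of the lens where both
series converge. The constants for u² and v² are read off at z = 1 and z = -1, approached along a
ray. Both come from the Wronskian constant 2 sin(νπ)/π, which Euler's sine product extracts from the
Taylor coefficients and Abel's theorem carries to the endpoint. Inverting the three relations gives
G = π/(2 sin νπ)·(u² - v²) + b·uv with b undetermined (`exists_cauchyTransform_legendreProd_eq`).

On the real axis the boundary value of G is the finite Hilbert transform of w minus πi·w
(`tendsto_cauchyTransform_ofReal_add`). Since w is even, its Hilbert transform is odd, and so is u²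
- v², while uv is even. The odd part of the identity is the claim for non-integer ν, and b drops
out.

For ν = n both sides are continued in ν: the Hilbert transform is continuous in ν by dominated
convergence, and the right side is rewritten through Q_ν so that its limit is visible. The parity of
P_n turns w into (-1)^n P_n². -/

/-! ### Hypergeometric coefficients, the flux series and their endpoint behaviour -/

/-- The `n`-th Taylor coefficient of `₂F₁(-ν, ν + 1; 1; s)`. -/
noncomputable def legendreCoeff (ν : ℂ) (n : ℕ) : ℂ :=
  (∏ j ∈ Finset.range n, ((j : ℂ) - ν) * (j + ν + 1)) / (n.factorial : ℂ) ^ 2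

/-- The hypergeometric series `₂F₁(-ν, ν + 1; 1; s)`. -/
noncomputable def legendreSeries (ν s : ℂ) : ℂ := ∑' n, legendreCoeff ν n * s ^ n

/-- The Taylor coefficients of `s (1 - s) f'(s)` where `f(s) = ₂F₁(-ν, ν + 1; 1; s)`. -/
noncomputable def legendreFluxCoeff (ν : ℂ) (n : ℕ) : ℂ :=
  n * legendreCoeff ν n - ((n - 1 : ℕ) : ℂ) * legendreCoeff ν (n - 1)

/-- The function `s (1 - s) f'(s)` where `f(s) = ₂F₁(-ν, ν + 1; 1; s)`. -/
noncomputable def legendreFlux (ν s : ℂ) : ℂ := ∑' n, legendreFluxCoeff ν n * s ^ n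

theorem ascPochhammer_eval_eq_prod (a : ℂ) (n : ℕ) :
    (ascPochhammer ℂ n).eval a = ∏ j ∈ Finset.range n, (a + j) := by
  induction n with
  | zero => simp
  | succ n ih => rw [ascPochhammer_succ_eval, ih, Finset.prod_range_succ]

theorem legendreP_eq_legendreSeries (ν : ℂ) (x : ℝ) :
    legendreP ν x = legendreSeries ν ((1 - x) / 2) := by
  unfold legendreP legendreSeries
  rw [ordinaryHypergeometric_eq_tsum]
  refine tsum_congr fun n => ?_
  rw [smul_eq_mul]
  congr 1
  rw [legendreCoeff, ascPochhammer_eval_eq_prod, ascPochhammer_eval_eq_prod,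
    ascPochhammer_eval_one, Finset.prod_mul_distrib, sq, div_eq_mul_inv, mul_inv]
  have h1 : ∏ j ∈ Finset.range n, (-ν + (j : ℂ)) = ∏ j ∈ Finset.range n, ((j : ℂ) - ν) :=
    Finset.prod_congr rfl fun j _ => by ring
  have h2 : ∏ j ∈ Finset.range n, (ν + 1 + (j : ℂ)) = ∏ j ∈ Finset.range n, ((j : ℂ) + ν + 1) :=
    Finset.prod_congr rfl fun j _ => by ring
  rw [h1, h2]
  ring

@[simp] theorem legendreCoeff_zero (ν : ℂ) : legendreCoeff ν 0 = 1 := by simp [legendreCoeff]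

@[simp] theorem legendreFluxCoeff_zero (ν : ℂ) : legendreFluxCoeff ν 0 = 0 := by
  simp [legendreFluxCoeff]

theorem legendreCoeff_succ (ν : ℂ) (n : ℕ) :
    ((n : ℂ) + 1) ^ 2 * legendreCoeff ν (n + 1) = ((n : ℂ) - ν) * (n + ν + 1) * legendreCoeff ν n := by
  have h : ((n : ℂ) + 1) ≠ 0 := Nat.cast_add_one_ne_zero n
  have h' : (n.factorial : ℂ) ≠ 0 := by exact_mod_cast n.factorial_ne_zero
  rw [legendreCoeff, legendreCoeff, Finset.prod_range_succ, Nat.factorial_succ]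
  push_cast
  field_simp

/-- Pairing j - ν with j + ν exposes the partial products of Euler's formula for the sine; the
factor 1 + ν/(n+1) is left over from the index shift. -/
theorem succ_mul_legendreCoeff_succ (ν : ℂ) (n : ℕ) :
    ((n : ℂ) + 1) * legendreCoeff ν (n + 1) =
      -ν * (1 + ν / (n + 1)) * ∏ j ∈ Finset.range n, (1 - ν ^ 2 / ((j : ℂ) + 1) ^ 2) := by
  induction n with
  | zero =>
    have := legendreCoeff_succ ν 0
    simp at this ⊢
    rw [this]; ring
  | succ n ih =>
    have h : ((n : ℂ) + 1) ≠ 0 := Nat.cast_add_one_ne_zero n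
    have h2 : ((n : ℂ) + 1 + 1) ≠ 0 := by exact_mod_cast Nat.cast_add_one_ne_zero (R := ℂ) (n + 1)
    have e := legendreCoeff_succ ν (n + 1)
    push_cast at e ⊢
    rw [Finset.prod_range_succ]
    set P := ∏ j ∈ Finset.range n, (1 - ν ^ 2 / ((j : ℂ) + 1) ^ 2)
    have e2 : ((n : ℂ) + 1 + 1) * legendreCoeff ν (n + 1 + 1) =
        ((n : ℂ) + 1 - ν) * (n + 1 + ν + 1) / ((n + 1 + 1) * (n + 1))
          * (((n : ℂ) + 1) * legendreCoeff ν (n + 1)) := by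
      field_simp
      linear_combination e
    rw [e2, ih]
    field_simp
    ring

theorem tendsto_mul_legendreCoeff (ν : ℂ) :
    Tendsto (fun n : ℕ => (n : ℂ) * legendreCoeff ν n) atTop
      (𝓝 (-(Complex.sin (ν * Real.pi) / Real.pi))) := by
  rw [← tendsto_add_atTop_iff_nat 1]
  have hpi : (Real.pi : ℂ) ≠ 0 := by exact_mod_cast Real.pi_ne_zero
  have h1 : Tendsto (fun n : ℕ => 1 + ν / ((n : ℂ) + 1)) atTop (𝓝 1) := by
    have := (tendsto_one_div_add_atTop_nhds_zero_nat (𝕜 := ℂ)).const_mul ν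
    simpa [div_eq_mul_inv] using this.const_add 1
  have h2 := ((Complex.tendsto_euler_sin_prod ν).mul h1).mul_const (-(1 / (Real.pi : ℂ)))
  rw [mul_comm ν]
  convert! h2 using 1
  · ext n
    push_cast
    rw [succ_mul_legendreCoeff_succ]
    field_simp
  · congr 1; ring

/-- One bound serves a whole disc of degrees; this later gives holomorphy of P_ν and continuity of
the Hilbert transform in ν. -/
theorem exists_norm_mul_legendreCoeff_le (R : ℝ) :
    ∃ K : ℝ, 0 ≤ K ∧ ∀ ν : ℂ, ‖ν‖ ≤ R → ∀ n : ℕ, ‖(n : ℂ) * legendreCoeff ν n‖ ≤ K := by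
  have hs : Summable (fun j : ℕ => R ^ 2 / ((j : ℝ) + 1) ^ 2) := by
    have := (summable_nat_add_iff 1).mpr (Real.summable_one_div_nat_pow.mpr one_lt_two)
    simpa [div_eq_mul_inv] using this.mul_left (R ^ 2)
  refine ⟨|R| * (1 + |R|) * Real.exp (∑' j : ℕ, R ^ 2 / ((j : ℝ) + 1) ^ 2), by positivity, ?_⟩
  intro ν hν n
  have hR : ‖ν‖ ≤ |R| := hν.trans (le_abs_self R)
  rcases n with _ | n
  · simp; positivity
  push_cast
  rw [succ_mul_legendreCoeff_succ, norm_mul, norm_mul, norm_neg]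
  have hprod : ‖∏ j ∈ Finset.range n, (1 - ν ^ 2 / ((j : ℂ) + 1) ^ 2)‖ ≤
      Real.exp (∑' j : ℕ, R ^ 2 / ((j : ℝ) + 1) ^ 2) := by
    rw [norm_prod]
    calc ∏ j ∈ Finset.range n, ‖1 - ν ^ 2 / ((j : ℂ) + 1) ^ 2‖
        ≤ ∏ j ∈ Finset.range n, Real.exp (R ^ 2 / ((j : ℝ) + 1) ^ 2) := by
          refine Finset.prod_le_prod (fun _ _ => norm_nonneg _) fun j _ => ?_
          have e : ‖ν ^ 2 / ((j : ℂ) + 1) ^ 2‖ ≤ R ^ 2 / ((j : ℝ) + 1) ^ 2 := by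
            rw [norm_div, norm_pow, norm_pow, ← Nat.cast_add_one, Complex.norm_natCast]
            push_cast
            rw [← sq_abs R]
            gcongr
          calc ‖1 - ν ^ 2 / ((j : ℂ) + 1) ^ 2‖ ≤ 1 + ‖ν ^ 2 / ((j : ℂ) + 1) ^ 2‖ := by
                rw [← norm_one (α := ℂ)]
                exact norm_sub_le _ _
            _ ≤ R ^ 2 / ((j : ℝ) + 1) ^ 2 + 1 := by linarith
            _ ≤ _ := Real.add_one_le_exp _
      _ = Real.exp (∑ j ∈ Finset.range n, R ^ 2 / ((j : ℝ) + 1) ^ 2) := (Real.exp_sum _ _).symm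
      _ ≤ _ := Real.exp_le_exp.mpr (hs.sum_le_tsum _ fun j _ => by positivity)
  have h1 : ‖1 + ν / ((n : ℂ) + 1)‖ ≤ 1 + |R| := by
    refine (norm_add_le _ _).trans ?_
    rw [norm_one, norm_div, ← Nat.cast_add_one, Complex.norm_natCast]
    push_cast
    have : ‖ν‖ / ((n : ℝ) + 1) ≤ ‖ν‖ := div_le_self (norm_nonneg _) (by linarith [n.cast_nonneg (α := ℝ)])
    linarith
  gcongr

/-- A power series with bounded coefficients may be differentiated termwise in the unit disc. -/
theorem hasDerivAt_tsum_mul_pow {c : ℕ → ℂ} {K : ℝ} (hc : ∀ n, ‖c n‖ ≤ K) {s : ℂ} (hs : ‖s‖ < 1) :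
    HasDerivAt (fun s => ∑' n, c n * s ^ n) (∑' n, c n * (n * s ^ (n - 1))) s := by
  obtain ⟨r, hr, hr1⟩ := exists_between hs
  have hr0 : 0 ≤ r := (norm_nonneg s).trans hr.le
  have hsum : Summable fun n : ℕ => K * (n * r ^ (n - 1)) := by
    refine Summable.mul_left K ?_
    rw [← summable_nat_add_iff 1]
    have h := summable_pow_mul_geometric_of_norm_lt_one 1 (r := r) (by rwa [Real.norm_of_nonneg hr0])
    have h2 := summable_geometric_of_lt_one hr0 hr1
    refine (h.add h2).congr fun n => ?_
    push_cast
    simp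
    ring
  refine hasDerivAt_tsum_of_isPreconnected (t := Metric.ball 0 r) (y₀ := 0) hsum Metric.isOpen_ball
    (convex_ball (0 : ℂ) r).isPreconnected (g := fun n s => c n * s ^ n)
    (g' := fun n s => c n * (n * s ^ (n - 1))) ?_ ?_ ?_ ?_ ?_
  · intro n y _
    exact (hasDerivAt_pow n y).const_mul (c n)
  · intro n y hy
    have hy' : ‖y‖ ≤ r := by simpa using (Metric.mem_ball.mp hy).le
    rw [norm_mul, norm_mul, norm_pow, Complex.norm_natCast]
    have : 0 ≤ K := (norm_nonneg _).trans (hc 0)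
    gcongr
    exact hc n
  · simpa using (norm_nonneg s).trans_lt hr
  · refine summable_of_ne_finset_zero (s := {0}) fun n hn => ?_
    simp at hn
    simp [hn]
  · simpa using hr

theorem summable_mul_pow_of_bounded {c : ℕ → ℂ} {K : ℝ} (hc : ∀ n, ‖c n‖ ≤ K) {s : ℂ}
    (hs : ‖s‖ < 1) : Summable fun n => c n * s ^ n := by
  refine Summable.of_norm_bounded ((summable_geometric_of_lt_one (norm_nonneg s) hs).mul_left K) ?_
  intro n
  rw [norm_mul, norm_pow]
  gcongr
  exact hc n

theorem exists_norm_legendreCoeff_le (ν : ℂ) : ∃ K : ℝ, ∀ n, ‖legendreCoeff ν n‖ ≤ K := by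
  obtain ⟨K, hK0, hK⟩ := exists_norm_mul_legendreCoeff_le ‖ν‖
  refine ⟨K + 1, fun n => ?_⟩
  rcases n with _ | n
  · simp [hK0]
  · have := hK ν le_rfl (n + 1)
    rw [norm_mul, Complex.norm_natCast] at this
    push_cast at this
    nlinarith [norm_nonneg (legendreCoeff ν (n + 1)), n.cast_nonneg (α := ℝ)]

theorem norm_legendreFluxCoeff_le {ν : ℂ} {K : ℝ} (hK : ∀ n : ℕ, ‖(n : ℂ) * legendreCoeff ν n‖ ≤ K)
    (n : ℕ) : ‖legendreFluxCoeff ν n‖ ≤ 2 * K := by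
  refine (norm_sub_le _ _).trans ?_
  linarith [hK n, hK (n - 1)]

/-- The telescoping turns the asymptotics of n·c_n into convergence of the flux series at s = 1,
which is what Abel's limit theorem needs. -/
theorem sum_range_legendreFluxCoeff (ν : ℂ) (n : ℕ) :
    ∑ i ∈ Finset.range (n + 1), legendreFluxCoeff ν i = n * legendreCoeff ν n := by
  induction n with
  | zero => simp
  | succ n ih =>
    rw [Finset.sum_range_succ, ih, legendreFluxCoeff]
    simp

theorem legendreSeries_zero (ν : ℂ) : legendreSeries ν 0 = 1 := by
  unfold legendreSeries
  rw [tsum_eq_single 0]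
  · simp
  · intro n hn
    simp [hn]

theorem legendreFlux_zero (ν : ℂ) : legendreFlux ν 0 = 0 := by
  unfold legendreFlux
  rw [tsum_eq_single 0]
  · simp
  · intro n hn
    simp [hn]

theorem legendreFlux_eq (ν : ℂ) {s : ℂ} (hs : ‖s‖ < 1) :
    legendreFlux ν s = (1 - s) * ∑' n : ℕ, ((n : ℂ) * legendreCoeff ν n) * s ^ n := by
  obtain ⟨K, hK0, hK⟩ := exists_norm_mul_legendreCoeff_le ‖ν‖
  have hsum := summable_mul_pow_of_bounded (hK ν le_rfl) hs
  have h1 : Summable fun n : ℕ => (((n - 1 : ℕ) : ℂ) * legendreCoeff ν (n - 1)) * s ^ n :=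
    summable_mul_pow_of_bounded (fun n => hK ν le_rfl (n - 1)) hs
  have h2 : ∑' n : ℕ, (((n - 1 : ℕ) : ℂ) * legendreCoeff ν (n - 1)) * s ^ n =
      s * ∑' n : ℕ, ((n : ℂ) * legendreCoeff ν n) * s ^ n := by
    rw [h1.tsum_eq_zero_add, ← tsum_mul_left]
    simp only [zero_tsub, Nat.cast_zero, zero_mul, zero_add, add_tsub_cancel_right]
    exact tsum_congr fun n => by ring
  unfold legendreFlux legendreFluxCoeff
  simp_rw [sub_mul]
  rw [hsum.tsum_sub h1, h2]
  ring

theorem hasDerivAt_legendreSeries (ν : ℂ) {s : ℂ} (hs : ‖s‖ < 1) (hs0 : s ≠ 0) :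
    HasDerivAt (legendreSeries ν) (legendreFlux ν s / (s * (1 - s))) s := by
  obtain ⟨K, hK⟩ := exists_norm_legendreCoeff_le ν
  have hs1 : 1 - s ≠ 0 := by
    intro h
    rw [sub_eq_zero] at h
    simp [← h] at hs
  convert! hasDerivAt_tsum_mul_pow hK hs using 1
  rw [legendreFlux_eq ν hs, mul_comm s, mul_div_mul_left _ _ hs1, div_eq_iff hs0, ← tsum_mul_right]
  refine tsum_congr fun n => ?_
  rcases n with _ | n
  · simp
  · simp only [add_tsub_cancel_right, pow_succ]
    ring

/-- This is Legendre's equation in self-adjoint form. Termwise it is the coefficient recurrence,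
because (n-ν)(n+ν+1) - n(n+1) = -ν(ν+1). -/
theorem hasDerivAt_legendreFlux (ν : ℂ) {s : ℂ} (hs : ‖s‖ < 1) :
    HasDerivAt (legendreFlux ν) (-(ν * (ν + 1)) * legendreSeries ν s) s := by
  obtain ⟨K, hK0, hK⟩ := exists_norm_mul_legendreCoeff_le ‖ν‖
  have hE := norm_legendreFluxCoeff_le (hK ν le_rfl)
  convert! hasDerivAt_tsum_mul_pow hE hs using 1
  have hterm : ∀ n : ℕ, legendreFluxCoeff ν (n + 1) * (((n + 1 : ℕ) : ℂ) * s ^ (n + 1 - 1)) =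
      -(ν * (ν + 1)) * (legendreCoeff ν n * s ^ n) := by
    intro n
    have h := legendreCoeff_succ ν n
    simp only [legendreFluxCoeff, add_tsub_cancel_right]
    push_cast
    linear_combination s ^ n * h
  obtain ⟨C, hC⟩ := exists_norm_legendreCoeff_le ν
  have hsum : Summable fun n : ℕ => legendreFluxCoeff ν n * ((n : ℂ) * s ^ (n - 1)) := by
    rw [← summable_nat_add_iff 1]
    simp_rw [hterm]
    exact (summable_mul_pow_of_bounded hC hs).mul_left _
  rw [hsum.tsum_eq_zero_add]
  simp_rw [hterm]
  rw [tsum_mul_left, legendreSeries]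
  simp

theorem tendsto_legendreFlux_one (ν : ℂ) :
    Tendsto (fun t : ℝ => legendreFlux ν t) (𝓝[<] 1)
      (𝓝 (-(Complex.sin (ν * Real.pi) / Real.pi))) := by
  have h : Tendsto (fun n => ∑ i ∈ Finset.range n, legendreFluxCoeff ν i) atTop
      (𝓝 (-(Complex.sin (ν * Real.pi) / Real.pi))) := by
    rw [← tendsto_add_atTop_iff_nat 1]
    simp_rw [sum_range_legendreFluxCoeff]
    exact tendsto_mul_legendreCoeff ν
  exact tendsto_map'_iff.mp (Complex.tendsto_tsum_powerSeries_nhdsWithin_lt h)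

/-- The factor 1 - t cancels the geometric sum t/(1-t), so the flux stays bounded near t = 1 and
vanishes linearly at t = 0. -/
theorem norm_legendreFlux_le {ν : ℂ} {K : ℝ} (hK : ∀ n : ℕ, ‖(n : ℂ) * legendreCoeff ν n‖ ≤ K)
    {t : ℝ} (ht0 : 0 < t) (ht1 : t < 1) : ‖legendreFlux ν t‖ ≤ K * t := by
  have hs : ‖(t : ℂ)‖ < 1 := by simpa [abs_of_pos ht0]
  have hsum := summable_mul_pow_of_bounded hK hs
  rw [legendreFlux_eq ν hs, hsum.tsum_eq_zero_add, norm_mul]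
  have h1 : ‖(1 : ℂ) - t‖ = 1 - t := by
    rw [← Complex.ofReal_one, ← Complex.ofReal_sub, Complex.norm_real,
      Real.norm_of_nonneg (by linarith)]
  have hg := ((summable_geometric_of_lt_one ht0.le ht1).mul_left (K * t)).hasSum
  rw [tsum_mul_left, tsum_geometric_of_lt_one ht0.le ht1] at hg
  have h2 : ‖∑' n : ℕ, (((n + 1 : ℕ) : ℂ) * legendreCoeff ν (n + 1)) * (t : ℂ) ^ (n + 1)‖ ≤
      K * t * (1 - t)⁻¹ := by
    refine tsum_of_norm_bounded hg fun n => ?_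
    rw [norm_mul, norm_pow, Complex.norm_real, Real.norm_of_nonneg ht0.le, mul_assoc, ← pow_succ']
    gcongr
    exact hK (n + 1)
  simp only [Nat.cast_zero, zero_mul, zero_add]
  rw [h1]
  calc (1 - t) * _ ≤ (1 - t) * (K * t * (1 - t)⁻¹) := by gcongr
    _ = K * t := by
      have : 1 - t ≠ 0 := by linarith
      field_simp

theorem norm_legendreSeries_le {ν : ℂ} {K : ℝ} (hK : ∀ n : ℕ, ‖(n : ℂ) * legendreCoeff ν n‖ ≤ K)
    {t : ℝ} (ht0 : 0 < t) (ht1 : t < 1) :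
    ‖legendreSeries ν t‖ ≤ (1 + 4 * K) * (1 - t) ^ (-(1 / 4) : ℝ) := by
  have hs : ‖(t : ℂ)‖ < 1 := by simpa [abs_of_pos ht0]
  have hK0 : 0 ≤ K := (norm_nonneg _).trans (hK 0)
  obtain ⟨C, hC⟩ := exists_norm_legendreCoeff_le ν
  have hsum := summable_mul_pow_of_bounded hC hs
  have hg := (Real.hasSum_pow_div_log_of_abs_lt_one (by rwa [abs_of_pos ht0])).mul_left K
  have h2 : ‖∑' n : ℕ, legendreCoeff ν (n + 1) * (t : ℂ) ^ (n + 1)‖ ≤ K * -Real.log (1 - t) := by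
    refine tsum_of_norm_bounded hg fun n => ?_
    rw [norm_mul, norm_pow, Complex.norm_real, Real.norm_of_nonneg ht0.le]
    have h := hK (n + 1)
    rw [norm_mul, Complex.norm_natCast] at h
    push_cast at h
    have hn : (0 : ℝ) < n + 1 := by positivity
    have h3 : ‖legendreCoeff ν (n + 1)‖ ≤ K / (n + 1) := by
      rw [le_div_iff₀ hn]; linarith
    calc _ ≤ K / (n + 1) * t ^ (n + 1) := by gcongr
      _ = _ := by ring
  -- The logarithmic singularity is traded for a power. Exponent 1/4 is small enough that a product
  -- of two such bounds remains integrable.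
  have h3 : -Real.log (1 - t) ≤ 4 * (1 - t) ^ (-(1 / 4) : ℝ) := by
    rw [← Real.log_inv]
    have := Real.log_le_rpow_div (x := (1 - t)⁻¹) (by simp; linarith) (ε := 1 / 4) (by norm_num)
    rw [Real.inv_rpow (by linarith), ← Real.rpow_neg (by linarith)] at this
    linarith
  have h4 : 1 ≤ (1 - t) ^ (-(1 / 4) : ℝ) :=
    Real.one_le_rpow_of_pos_of_le_one_of_nonpos (by linarith) (by linarith) (by norm_num)
  rw [legendreSeries, hsum.tsum_eq_zero_add]
  simp only [legendreCoeff_zero, pow_zero, mul_one]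
  refine (norm_add_le _ _).trans ?_
  rw [norm_one]
  nlinarith

/-! ### Cauchy transforms in the upper half plane -/

/-- The Cauchy transform of a function on `(-1, 1)`. -/
noncomputable def cauchyTransform (g : ℝ → ℂ) (z : ℂ) : ℂ := ∫ ξ in Ioo (-1 : ℝ) 1, g ξ / (z - ξ)

theorem im_le_norm_sub_ofReal (z : ℂ) (ξ : ℝ) : z.im ≤ ‖z - ξ‖ := by
  simpa using (le_abs_self _).trans (Complex.abs_im_le_norm (z - ξ))

theorem sub_ofReal_ne_zero {z : ℂ} (hz : 0 < z.im) (ξ : ℝ) : z - ξ ≠ 0 :=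
  norm_pos_iff.mp (hz.trans_le (im_le_norm_sub_ofReal z ξ))

theorem continuous_inv_sub_ofReal_pow {z : ℂ} (hz : 0 < z.im) (k : ℕ) :
    Continuous fun ξ : ℝ => ((z - ξ) ^ k)⁻¹ :=
  Continuous.inv₀ (by fun_prop) fun ξ => pow_ne_zero k (sub_ofReal_ne_zero hz ξ)

theorem norm_inv_sub_ofReal_pow_le {z : ℂ} {y : ℝ} (hy : 0 < y) (hz : y ≤ z.im) (k : ℕ) (ξ : ℝ) :
    ‖((z - ξ) ^ k)⁻¹‖ ≤ (y ^ k)⁻¹ := by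
  rw [norm_inv, norm_pow]
  have := hz.trans (im_le_norm_sub_ofReal z ξ)
  gcongr

theorem integrableOn_div_sub_ofReal_pow {g : ℝ → ℂ} (hg : IntegrableOn g (Ioo (-1 : ℝ) 1)) {z : ℂ}
    (hz : 0 < z.im) (k : ℕ) : IntegrableOn (fun ξ : ℝ => g ξ / (z - ξ) ^ k) (Ioo (-1 : ℝ) 1) := by
  simp_rw [div_eq_mul_inv]
  exact Integrable.mul_bdd hg (continuous_inv_sub_ofReal_pow hz k).aestronglyMeasurable
    (ae_of_all _ fun ξ => norm_inv_sub_ofReal_pow_le hz le_rfl k ξ)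

theorem integrableOn_div_sub_ofReal {g : ℝ → ℂ} (hg : IntegrableOn g (Ioo (-1 : ℝ) 1)) {z : ℂ}
    (hz : 0 < z.im) : IntegrableOn (fun ξ : ℝ => g ξ / (z - ξ)) (Ioo (-1 : ℝ) 1) := by
  simpa using integrableOn_div_sub_ofReal_pow hg hz 1

theorem hasDerivAt_cauchyTransform {g : ℝ → ℂ} (hg : IntegrableOn g (Ioo (-1 : ℝ) 1)) {z : ℂ}
    (hz : 0 < z.im) :
    HasDerivAt (cauchyTransform g) (-∫ ξ in Ioo (-1 : ℝ) 1, g ξ / (z - ξ) ^ 2) z := by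
  have hs : {w : ℂ | z.im / 2 < w.im} ∈ 𝓝 z :=
    (isOpen_lt continuous_const Complex.continuous_im).mem_nhds (by simp; linarith)
  rw [← integral_neg]
  refine (hasDerivAt_integral_of_dominated_loc_of_deriv_le (F := fun z ξ => g ξ / (z - ξ))
    (F' := fun z ξ => -(g ξ / (z - ξ) ^ 2)) (bound := fun ξ => ‖g ξ‖ * ((z.im / 2) ^ 2)⁻¹)
    hs ?_ ?_ ?_ ?_ ?_ ?_).2
  · filter_upwards [hs] with w hw
    exact (integrableOn_div_sub_ofReal hg ((half_pos hz).trans hw)).aestronglyMeasurable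
  · exact integrableOn_div_sub_ofReal hg hz
  · exact (integrableOn_div_sub_ofReal_pow hg hz 2).aestronglyMeasurable.neg
  · refine ae_of_all _ fun ξ w hw => ?_
    rw [norm_neg, div_eq_mul_inv, norm_mul]
    gcongr
    exact norm_inv_sub_ofReal_pow_le (half_pos hz) (le_of_lt hw) 2 ξ
  · exact hg.norm.mul_const _
  · refine ae_of_all _ fun ξ w hw => ?_
    have hne := sub_ofReal_ne_zero ((half_pos hz).trans hw) ξ
    convert! (hasDerivAt_const w (g ξ)).div ((hasDerivAt_id w).sub_const (ξ : ℂ)) hne using 1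
    simp [neg_div]

theorem integral_Ioo_eq_sub_of_hasDerivAt {F F' : ℝ → ℂ} {A B : ℂ}
    (hF : ∀ x ∈ Ioo (-1 : ℝ) 1, HasDerivAt F (F' x) x) (hint : IntegrableOn F' (Ioo (-1 : ℝ) 1))
    (hA : Tendsto F (𝓝[>] (-1)) (𝓝 A)) (hB : Tendsto F (𝓝[<] 1) (𝓝 B)) :
    ∫ x in Ioo (-1 : ℝ) 1, F' x = B - A := by
  rw [← integral_Ioc_eq_integral_Ioo, ← intervalIntegral.integral_of_le (by norm_num)]
  refine intervalIntegral.integral_eq_sub_of_hasDerivAt_of_tendsto (by norm_num) hF ?_ hA hB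
  rw [intervalIntegrable_iff_integrableOn_Ioo_of_le (by norm_num)]
  exact hint

/-- Integration by parts against the Cauchy kernel. -/
theorem integral_div_sub_sq_eq_neg {g g' : ℝ → ℂ}
    (hg' : ∀ x ∈ Ioo (-1 : ℝ) 1, HasDerivAt g (g' x) x)
    (hgi : IntegrableOn g (Ioo (-1 : ℝ) 1)) (hgi' : IntegrableOn g' (Ioo (-1 : ℝ) 1))
    (hA : Tendsto g (𝓝[>] (-1)) (𝓝 0)) (hB : Tendsto g (𝓝[<] 1) (𝓝 0)) {z : ℂ} (hz : 0 < z.im) :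
    -∫ ξ in Ioo (-1 : ℝ) 1, g ξ / (z - ξ) ^ 2 = cauchyTransform g' z := by
  have h1 := integrableOn_div_sub_ofReal hgi' hz
  have h2 := integrableOn_div_sub_ofReal_pow hgi hz 2
  have hc := (continuous_inv_sub_ofReal_pow hz 1)
  simp only [pow_one] at hc
  have key := integral_Ioo_eq_sub_of_hasDerivAt (F := fun ξ => g ξ * (z - ξ)⁻¹)
    (F' := fun ξ => g' ξ / (z - ξ) + g ξ / (z - ξ) ^ 2) (A := 0) (B := 0) ?_ (h1.add h2) ?_ ?_
  · rw [integral_add h1 h2, sub_self] at key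
    unfold cauchyTransform
    linear_combination -key
  · intro x hx
    have hne := sub_ofReal_ne_zero hz x
    have hd : HasDerivAt (fun ξ : ℝ => z - (ξ : ℂ)) (-1) x := by
      simpa using (Complex.ofRealCLM.hasDerivAt (x := x)).const_sub z
    convert! (hg' x hx).mul (hd.inv hne) using 1
    simp only [Pi.inv_apply]
    field_simp
  · simpa using hA.mul ((hc.tendsto (-1)).mono_left nhdsWithin_le_nhds)
  · simpa using hB.mul ((hc.tendsto 1).mono_left nhdsWithin_le_nhds)

theorem integral_Ioo_eq_zero_of_odd {g : ℝ → ℂ} (hg : ∀ x ∈ Ioo (-1 : ℝ) 1, g (-x) = -g x) :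
    ∫ ξ in Ioo (-1 : ℝ) 1, g ξ = 0 := by
  have h : ∫ ξ in Ioo (-1 : ℝ) 1, g (-ξ) = ∫ ξ in Ioo (-1 : ℝ) 1, g ξ := by
    rw [← integral_Ioc_eq_integral_Ioo, ← intervalIntegral.integral_of_le (by norm_num),
      ← integral_Ioc_eq_integral_Ioo, ← intervalIntegral.integral_of_le (by norm_num),
      intervalIntegral.integral_comp_neg]
    simp
  rw [setIntegral_congr_fun measurableSet_Ioo hg, integral_neg] at h
  exact self_eq_neg.mp h.symm

theorem integrableOn_bdd_mul {g φ : ℝ → ℂ} (hg : IntegrableOn g (Ioo (-1 : ℝ) 1))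
    (hφ : Continuous φ) : IntegrableOn (fun ξ => φ ξ * g ξ) (Ioo (-1 : ℝ) 1) := by
  obtain ⟨C, hC⟩ := isCompact_Icc (a := (-1 : ℝ)) (b := 1) |>.exists_bound_of_continuousOn
    hφ.continuousOn
  refine Integrable.bdd_mul (c := C) hg hφ.aestronglyMeasurable ?_
  filter_upwards [ae_restrict_mem measurableSet_Ioo] with x hx
  exact hC x (Ioo_subset_Icc_self hx)

/-- If `(1 - x²) w' = h` on `(-1, 1)`, the Cauchy transforms of `w` and `h` satisfy the same
relation up to the total mass of `w`. -/
theorem one_sub_sq_mul_deriv_cauchyTransform {w h : ℝ → ℂ}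
    (hw' : ∀ x ∈ Ioo (-1 : ℝ) 1, HasDerivAt w (h x / (1 - (x : ℂ) ^ 2)) x)
    (hw : IntegrableOn w (Ioo (-1 : ℝ) 1)) (hh : IntegrableOn h (Ioo (-1 : ℝ) 1))
    (hA : Tendsto (fun x : ℝ => (1 - (x : ℂ) ^ 2) * w x) (𝓝[>] (-1)) (𝓝 0))
    (hB : Tendsto (fun x : ℝ => (1 - (x : ℂ) ^ 2) * w x) (𝓝[<] 1) (𝓝 0)) {z : ℂ} (hz : 0 < z.im) :
    (1 - z ^ 2) * (-∫ ξ in Ioo (-1 : ℝ) 1, w ξ / (z - ξ) ^ 2) =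
      cauchyTransform h z + ∫ ξ in Ioo (-1 : ℝ) 1, w ξ := by
  have hξ : IntegrableOn (fun ξ : ℝ => (2 * (ξ : ℂ)) * w ξ) (Ioo (-1 : ℝ) 1) :=
    integrableOn_bdd_mul hw (by fun_prop)
  have hp : IntegrableOn (fun ξ : ℝ => (1 - (ξ : ℂ) ^ 2) * w ξ) (Ioo (-1 : ℝ) 1) :=
    integrableOn_bdd_mul hw (by fun_prop)
  have hd : ∀ x ∈ Ioo (-1 : ℝ) 1, HasDerivAt (fun x : ℝ => (1 - (x : ℂ) ^ 2) * w x)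
      (h x - (2 * (x : ℂ)) * w x) x := by
    intro x hx
    have hne : (1 : ℂ) - (x : ℂ) ^ 2 ≠ 0 := by
      have : (1 : ℝ) - x ^ 2 ≠ 0 := by nlinarith [hx.1, hx.2]
      exact_mod_cast this
    have hd1 : HasDerivAt (fun x : ℝ => 1 - (x : ℂ) ^ 2) (-(2 * (x : ℂ))) x := by
      simpa using ((Complex.ofRealCLM.hasDerivAt (x := x)).pow 2).const_sub 1
    convert! hd1.mul (hw' x hx) using 1
    field_simp
    ring
  have ibp := integral_div_sub_sq_eq_neg hd hp (hh.sub hξ) hA hB hz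
  have e1 : cauchyTransform (fun x => h x - (2 * (x : ℂ)) * w x) z =
      cauchyTransform h z - ∫ ξ in Ioo (-1 : ℝ) 1, (2 * (ξ : ℂ)) * w ξ / (z - ξ) := by
    unfold cauchyTransform
    rw [← integral_sub (integrableOn_div_sub_ofReal hh hz) (integrableOn_div_sub_ofReal hξ hz)]
    simp_rw [sub_div]
  -- Pointwise, 1 - z² = (1 - ξ²) - (z-ξ)(z+ξ) and (z+ξ)/(z-ξ) = 1 + 2ξ/(z-ξ). The 2ξ term cancels
  -- the one from differentiating (1-ξ²)w, and the 1 leaves the mass of w.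
  have e2 : (1 - z ^ 2) * (∫ ξ in Ioo (-1 : ℝ) 1, w ξ / (z - ξ) ^ 2) =
      (∫ ξ in Ioo (-1 : ℝ) 1, (1 - (ξ : ℂ) ^ 2) * w ξ / (z - ξ) ^ 2) -
        (∫ ξ in Ioo (-1 : ℝ) 1, (2 * (ξ : ℂ)) * w ξ / (z - ξ)) - ∫ ξ in Ioo (-1 : ℝ) 1, w ξ := by
    have hs : IntegrableOn (fun ξ : ℝ => (1 - (ξ : ℂ) ^ 2) * w ξ / (z - ξ) ^ 2 -
        (2 * (ξ : ℂ)) * w ξ / (z - ξ)) (Ioo (-1 : ℝ) 1) :=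
      (integrableOn_div_sub_ofReal_pow hp hz 2).sub (integrableOn_div_sub_ofReal hξ hz)
    rw [← integral_const_mul, ← integral_sub (integrableOn_div_sub_ofReal_pow hp hz 2)
      (integrableOn_div_sub_ofReal hξ hz), ← integral_sub hs hw]
    congr 1 with ξ
    have := sub_ofReal_ne_zero hz ξ
    field_simp
    ring
  rw [e1] at ibp
  linear_combination -e2 + ibp

/-- Here 1 - ξ² = (1 - z²) + (z-ξ)(z+ξ), and evenness removes the first moment. The surviving term
z·∫w dictates the linear correction in `legendreTransformMomProd`. -/
theorem cauchyTransform_one_sub_sq_mul {w : ℝ → ℂ} (hw : IntegrableOn w (Ioo (-1 : ℝ) 1))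
    (heven : ∀ x ∈ Ioo (-1 : ℝ) 1, w (-x) = w x) {z : ℂ} (hz : 0 < z.im) :
    cauchyTransform (fun ξ => (1 - (ξ : ℂ) ^ 2) * w ξ) z =
      (1 - z ^ 2) * cauchyTransform w z + z * ∫ ξ in Ioo (-1 : ℝ) 1, w ξ := by
  have hξ : IntegrableOn (fun ξ : ℝ => (ξ : ℂ) * w ξ) (Ioo (-1 : ℝ) 1) :=
    integrableOn_bdd_mul hw (by fun_prop)
  have h0 : ∫ ξ in Ioo (-1 : ℝ) 1, (ξ : ℂ) * w ξ = 0 :=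
    integral_Ioo_eq_zero_of_odd fun x hx => by
      simp only [heven x hx]
      push_cast
      ring
  have hw1 := (integrableOn_div_sub_ofReal hw hz).const_mul (1 - z ^ 2)
  have hw2 : IntegrableOn (fun ξ => z * w ξ) (Ioo (-1 : ℝ) 1) := hw.const_mul z
  have hw3 : IntegrableOn (fun ξ : ℝ => (1 - z ^ 2) * (w ξ / (z - ξ)) + z * w ξ)
      (Ioo (-1 : ℝ) 1) := hw1.add hw2
  unfold cauchyTransform
  rw [← add_zero (_ + _), ← h0, ← integral_const_mul, ← integral_const_mul,
    ← integral_add hw1 hw2, ← integral_add hw3 hξ]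
  congr 1 with ξ
  have := sub_ofReal_ne_zero hz ξ
  field_simp
  ring

/-! ### Approaching the endpoints along a ray -/

/-- The point at distance `√2 δ` from the end point `σ = ±1` on a ray into the upper half disc. -/
noncomputable def cornerPoint (σ δ : ℝ) : ℂ := ⟨σ * (1 - δ), δ⟩

/-- The approach is nontangential: the real part of the point is off σ by δ, and its distance to the
real line is also δ. The Cauchy kernel is thus dominated by twice the kernel at the endpoint. -/
theorem norm_ofReal_sub_le_mul_norm_cornerPoint_sub {σ δ ξ : ℝ} (hσ : |σ| = 1) (hδ : 0 < δ) :
    |σ - ξ| ≤ 2 * ‖cornerPoint σ δ - ξ‖ := by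
  have h1 : |(cornerPoint σ δ - ξ).re| ≤ ‖cornerPoint σ δ - ξ‖ := Complex.abs_re_le_norm _
  have h2 : δ ≤ ‖cornerPoint σ δ - ξ‖ := im_le_norm_sub_ofReal (cornerPoint σ δ) ξ
  have h3 : (cornerPoint σ δ - ξ).re = σ - ξ - σ * δ := by
    simp [cornerPoint]; ring
  rw [h3] at h1
  have h4 : |σ * δ| = δ := by rw [abs_mul, hσ, abs_of_pos hδ, one_mul]
  have h5 := abs_add_le (σ - ξ - σ * δ) (σ * δ)
  rw [sub_add_cancel] at h5
  linarith

theorem tendsto_cornerPoint (σ : ℝ) : Tendsto (cornerPoint σ) (𝓝[>] 0) (𝓝 (σ : ℂ)) := by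
  have : (cornerPoint σ) = fun δ : ℝ => (σ : ℂ) * (1 - δ) + δ * Complex.I := by
    ext δ
    apply Complex.ext <;> simp [cornerPoint]
  rw [this]
  have hc : Continuous fun δ : ℝ => (σ : ℂ) * (1 - δ) + δ * Complex.I := by fun_prop
  simpa using (hc.tendsto 0).mono_left nhdsWithin_le_nhds

theorem abs_ofReal_sub_pos {σ ξ : ℝ} (hσ : |σ| = 1) (hξ : ξ ∈ Ioo (-1 : ℝ) 1) : 0 < |σ - ξ| := by
  rw [abs_pos, sub_ne_zero]
  rintro rfl
  rw [← hσ] at hξ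
  rcases abs_choice σ with h | h <;> rw [h] at hξ <;> simp at hξ

/-- Since |z-ξ| ≥ δ, the kernel times δ is at most 1 and tends to 0 pointwise. Thus a possible
blow-up of the transform is weaker than 1/δ, with no hypothesis on g beyond integrability. -/
theorem tendsto_mul_cauchyTransform_cornerPoint {g : ℝ → ℂ} {σ : ℝ} (hσ : |σ| = 1)
    (hg : IntegrableOn g (Ioo (-1 : ℝ) 1)) :
    Tendsto (fun δ : ℝ => (δ : ℂ) * cauchyTransform g (cornerPoint σ δ)) (𝓝[>] 0) (𝓝 0) := by
  simp_rw [cauchyTransform, ← integral_const_mul]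
  rw [← integral_zero ℝ ℂ (μ := volume.restrict (Ioo (-1) 1))]
  refine tendsto_integral_filter_of_dominated_convergence (fun ξ => ‖g ξ‖) ?_ ?_ hg.norm ?_
  · filter_upwards [self_mem_nhdsWithin] with δ hδ
    exact ((integrableOn_div_sub_ofReal hg (z := cornerPoint σ δ) hδ).const_mul _).aestronglyMeasurable
  · filter_upwards [self_mem_nhdsWithin] with δ (hδ : 0 < δ)
    refine ae_of_all _ fun ξ => ?_
    rw [norm_mul, norm_div, Complex.norm_real, Real.norm_of_nonneg hδ.le]
    have h2 : δ ≤ ‖cornerPoint σ δ - ξ‖ := im_le_norm_sub_ofReal (cornerPoint σ δ) ξ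
    rw [mul_div_left_comm]
    exact mul_le_of_le_one_right (norm_nonneg _) (div_le_one_of_le₀ h2 (norm_nonneg _))
  · filter_upwards [ae_restrict_mem measurableSet_Ioo] with ξ hξ
    have hne : (σ : ℂ) - ξ ≠ 0 := by
      rw [← Complex.ofReal_sub]
      exact_mod_cast abs_pos.mp (abs_ofReal_sub_pos hσ hξ)
    have h1 : Tendsto (fun δ : ℝ => (δ : ℂ)) (𝓝[>] 0) (𝓝 0) := by
      simpa using (Complex.continuous_ofReal.tendsto 0).mono_left nhdsWithin_le_nhds
    simpa using h1.mul (Tendsto.div tendsto_const_nhds ((tendsto_cornerPoint σ).sub_const (ξ : ℂ)) hne)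

theorem tendsto_cauchyTransform_cornerPoint {g : ℝ → ℂ} {σ : ℝ} (hσ : |σ| = 1)
    (hg : IntegrableOn g (Ioo (-1 : ℝ) 1))
    (hgσ : IntegrableOn (fun ξ : ℝ => g ξ / ((σ : ℂ) - ξ)) (Ioo (-1 : ℝ) 1)) :
    Tendsto (fun δ : ℝ => cauchyTransform g (cornerPoint σ δ)) (𝓝[>] 0)
      (𝓝 (∫ ξ in Ioo (-1 : ℝ) 1, g ξ / ((σ : ℂ) - ξ))) := by
  refine tendsto_integral_filter_of_dominated_convergence (fun ξ => 2 * ‖g ξ / ((σ : ℂ) - ξ)‖)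
    ?_ ?_ (hgσ.norm.const_mul 2) ?_
  · filter_upwards [self_mem_nhdsWithin] with δ hδ
    exact (integrableOn_div_sub_ofReal hg (z := cornerPoint σ δ) hδ).aestronglyMeasurable
  · filter_upwards [self_mem_nhdsWithin] with δ (hδ : 0 < δ)
    filter_upwards [ae_restrict_mem measurableSet_Ioo] with ξ hξ
    have h1 := norm_ofReal_sub_le_mul_norm_cornerPoint_sub (ξ := ξ) hσ hδ
    have h2 := abs_ofReal_sub_pos hσ hξ
    rw [norm_div, norm_div, ← Complex.ofReal_sub, Complex.norm_real, Real.norm_eq_abs,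
      ← mul_div_assoc, div_le_div_iff₀ (by linarith) h2]
    nlinarith [norm_nonneg (g ξ)]
  · filter_upwards [ae_restrict_mem measurableSet_Ioo] with ξ hξ
    have hne : (σ : ℂ) - ξ ≠ 0 := by
      rw [← Complex.ofReal_sub]
      exact_mod_cast abs_pos.mp (abs_ofReal_sub_pos hσ hξ)
    exact Tendsto.div tendsto_const_nhds ((tendsto_cornerPoint σ).sub_const (ξ : ℂ)) hne

/-! ### Legendre functions on the lens, and their Wronskian -/

/-- The Legendre function of the first kind on the disc `|1 - z| < 2`. -/
noncomputable def legendreFun (ν z : ℂ) : ℂ := legendreSeries ν ((1 - z) / 2)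

/-- The function `(1 - z²) P_ν'(z)` on the disc `|1 - z| < 2`. -/
noncomputable def legendreMom (ν z : ℂ) : ℂ := -2 * legendreFlux ν ((1 - z) / 2)

/-- The lens on which both `P_ν(z)` and `P_ν(-z)` are given by their power series. -/
def legendreLens : Set ℂ := {z | ‖1 - z‖ < 2 ∧ ‖1 + z‖ < 2}

theorem norm_one_sub_div_two_lt {z : ℂ} (hz : ‖1 - z‖ < 2) : ‖(1 - z) / 2‖ < 1 := by
  rw [norm_div, Complex.norm_two, div_lt_one two_pos]
  exact hz

theorem hasDerivAt_legendreFun (ν : ℂ) {z : ℂ} (hz : ‖1 - z‖ < 2) (hz1 : 1 - z ^ 2 ≠ 0) :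
    HasDerivAt (legendreFun ν) (legendreMom ν z / (1 - z ^ 2)) z := by
  have h1 : 1 - z ≠ 0 := fun h => hz1 (by linear_combination (1 + z) * h)
  have h2 : 1 + z ≠ 0 := fun h => hz1 (by linear_combination (1 - z) * h)
  have hd : HasDerivAt (fun z : ℂ => (1 - z) / 2) (-1 / 2) z := by
    simpa using ((hasDerivAt_id z).const_sub 1).div_const 2
  convert! (hasDerivAt_legendreSeries ν (norm_one_sub_div_two_lt hz) (by simpa using h1)).comp z hd
    using 1
  rw [legendreMom]
  have h3 : 2 - (1 - z) ≠ 0 := by convert h2 using 1; ring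
  have h4 : 1 - (1 - z) / 2 ≠ 0 := by
    intro h; apply h2; linear_combination 2 * h
  field_simp
  ring

theorem hasDerivAt_legendreMom (ν : ℂ) {z : ℂ} (hz : ‖1 - z‖ < 2) :
    HasDerivAt (legendreMom ν) (-(ν * (ν + 1)) * legendreFun ν z) z := by
  have hd : HasDerivAt (fun z : ℂ => (1 - z) / 2) (-1 / 2) z := by
    simpa using ((hasDerivAt_id z).const_sub 1).div_const 2
  convert! ((hasDerivAt_legendreFlux ν (norm_one_sub_div_two_lt hz)).comp z hd).const_mul (-2)
    using 1
  rw [legendreFun]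
  ring

theorem hasDerivAt_legendreFun_neg (ν : ℂ) {z : ℂ} (hz : ‖1 + z‖ < 2) (hz1 : 1 - z ^ 2 ≠ 0) :
    HasDerivAt (fun z => legendreFun ν (-z)) (-legendreMom ν (-z) / (1 - z ^ 2)) z := by
  have h := hasDerivAt_legendreFun ν (z := -z) (by simpa using hz) (by simpa using hz1)
  convert! h.comp z (hasDerivAt_neg z) using 1
  rw [neg_sq]
  ring

theorem hasDerivAt_legendreMom_neg (ν : ℂ) {z : ℂ} (hz : ‖1 + z‖ < 2) :
    HasDerivAt (fun z => legendreMom ν (-z)) (ν * (ν + 1) * legendreFun ν (-z)) z := by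
  have h := hasDerivAt_legendreMom ν (z := -z) (by simpa using hz)
  convert! h.comp z (hasDerivAt_neg z) using 1
  ring

theorem isOpen_legendreLens : IsOpen legendreLens :=
  (isOpen_lt (f := fun z : ℂ => ‖1 - z‖) (by fun_prop) continuous_const).inter
    (isOpen_lt (f := fun z : ℂ => ‖1 + z‖) (by fun_prop) continuous_const)

theorem convex_legendreLens : Convex ℝ legendreLens := by
  have h1 : {z : ℂ | ‖1 - z‖ < 2} = Metric.ball 1 2 := by
    ext z; simp [dist_eq_norm, norm_sub_rev]
  have h2 : {z : ℂ | ‖1 + z‖ < 2} = Metric.ball (-1) 2 := by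
    ext z; simp [dist_eq_norm, add_comm]
  have : legendreLens = Metric.ball 1 2 ∩ Metric.ball (-1) 2 := by
    rw [← h1, ← h2]; rfl
  rw [this]
  exact (convex_ball _ _).inter (convex_ball _ _)

theorem one_sub_sq_ne_zero_of_mem_legendreLens {z : ℂ} (hz : z ∈ legendreLens) : 1 - z ^ 2 ≠ 0 := by
  intro h
  rw [show 1 - z ^ 2 = (1 - z) * (1 + z) by ring, mul_eq_zero] at h
  rcases h with h | h
  · have h2 := hz.2
    rw [← sub_eq_zero.mp h] at h2
    norm_num at h2
  · have h2 := hz.1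
    rw [eq_neg_of_add_eq_zero_right h] at h2
    norm_num at h2

theorem ofReal_mem_legendreLens {x : ℝ} (hx : x ∈ Ioo (-1 : ℝ) 1) : (x : ℂ) ∈ legendreLens := by
  constructor
  · change ‖1 - (x : ℂ)‖ < 2
    rw [← Complex.ofReal_one, ← Complex.ofReal_sub, Complex.norm_real, Real.norm_eq_abs, abs_lt]
    constructor <;> linarith [hx.1, hx.2]
  · change ‖1 + (x : ℂ)‖ < 2
    rw [← Complex.ofReal_one, ← Complex.ofReal_add, Complex.norm_real, Real.norm_eq_abs, abs_lt]
    constructor <;> linarith [hx.1, hx.2]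

theorem legendreFun_one (ν : ℂ) : legendreFun ν 1 = 1 := by
  simp [legendreFun, legendreSeries_zero]

theorem legendreMom_one (ν : ℂ) : legendreMom ν 1 = 0 := by
  simp [legendreMom, legendreFlux_zero]

theorem continuousAt_legendreFun (ν : ℂ) {z : ℂ} (hz : ‖1 - z‖ < 2) :
    ContinuousAt (legendreFun ν) z := by
  obtain ⟨K, hK⟩ := exists_norm_legendreCoeff_le ν
  have h := (hasDerivAt_tsum_mul_pow hK (norm_one_sub_div_two_lt hz)).continuousAt
  exact ContinuousAt.comp (f := fun z : ℂ => (1 - z) / 2) h (by fun_prop)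

theorem legendreP_eq_legendreFun (ν : ℂ) (x : ℝ) : legendreP ν x = legendreFun ν x :=
  legendreP_eq_legendreSeries ν x

theorem norm_legendreMom_le {ν : ℂ} {K : ℝ} (hK : ∀ n : ℕ, ‖(n : ℂ) * legendreCoeff ν n‖ ≤ K)
    {x : ℝ} (hx : x ∈ Ioo (-1 : ℝ) 1) : ‖legendreMom ν x‖ ≤ K * (1 - x) := by
  have h := norm_legendreFlux_le hK (t := (1 - x) / 2) (by linarith [hx.2]) (by linarith [hx.1])
  push_cast at h
  rw [legendreMom, norm_mul, norm_neg, Complex.norm_two]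
  linarith

theorem norm_legendreFun_le {ν : ℂ} {K : ℝ} (hK : ∀ n : ℕ, ‖(n : ℂ) * legendreCoeff ν n‖ ≤ K)
    {x : ℝ} (hx : x ∈ Ioo (-1 : ℝ) 1) :
    ‖legendreFun ν x‖ ≤ (1 + 4 * K) * ((1 + x) / 2) ^ (-(1 / 4) : ℝ) := by
  have h := norm_legendreSeries_le hK (t := (1 - x) / 2) (by linarith [hx.2]) (by linarith [hx.1])
  push_cast at h
  rwa [show 1 - (1 - x) / 2 = (1 + x) / 2 by ring] at h

theorem neg_mem_Ioo_one {x : ℝ} (hx : x ∈ Ioo (-1 : ℝ) 1) : -x ∈ Ioo (-1 : ℝ) 1 :=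
  ⟨by linarith [hx.2], by linarith [hx.1]⟩

theorem norm_legendreMom_neg_le {ν : ℂ} {K : ℝ} (hK : ∀ n : ℕ, ‖(n : ℂ) * legendreCoeff ν n‖ ≤ K)
    {x : ℝ} (hx : x ∈ Ioo (-1 : ℝ) 1) : ‖legendreMom ν (-x)‖ ≤ K * (1 + x) := by
  simpa using norm_legendreMom_le hK (neg_mem_Ioo_one hx)

theorem norm_legendreFun_neg_le {ν : ℂ} {K : ℝ} (hK : ∀ n : ℕ, ‖(n : ℂ) * legendreCoeff ν n‖ ≤ K)
    {x : ℝ} (hx : x ∈ Ioo (-1 : ℝ) 1) :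
    ‖legendreFun ν (-x)‖ ≤ (1 + 4 * K) * ((1 - x) / 2) ^ (-(1 / 4) : ℝ) := by
  simpa [← sub_eq_add_neg] using norm_legendreFun_le hK (neg_mem_Ioo_one hx)

theorem mul_rpow_neg_quarter {y : ℝ} (hy : 0 < y) : y * y ^ (-(1 / 4) : ℝ) = y ^ (3 / 4 : ℝ) := by
  nth_rewrite 1 [← Real.rpow_one y]
  rw [← Real.rpow_add hy]
  norm_num

theorem norm_legendreMom_mul_legendreFun_neg_le {ν : ℂ} {K : ℝ}
    (hK : ∀ n : ℕ, ‖(n : ℂ) * legendreCoeff ν n‖ ≤ K) {x : ℝ} (hx : x ∈ Ioo (-1 : ℝ) 1) :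
    ‖legendreMom ν x * legendreFun ν (-x)‖ ≤ 2 * K * (1 + 4 * K) * ((1 - x) / 2) ^ (3 / 4 : ℝ) := by
  have hK0 : 0 ≤ K := (norm_nonneg _).trans (hK 0)
  have hy : 0 < (1 - x) / 2 := by linarith [hx.2]
  rw [norm_mul, ← mul_rpow_neg_quarter hy]
  calc _ ≤ (K * (1 - x)) * ((1 + 4 * K) * ((1 - x) / 2) ^ (-(1 / 4) : ℝ)) :=
        mul_le_mul (norm_legendreMom_le hK hx) (norm_legendreFun_neg_le hK hx) (norm_nonneg _)
          (by nlinarith [hx.2])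
    _ = _ := by ring

/-- The linear zero of the flux of P_ν at 1 beats the singularity of P_ν(-x) there. -/
theorem tendsto_legendreMom_mul_legendreFun_neg (ν : ℂ) :
    Tendsto (fun x : ℝ => legendreMom ν x * legendreFun ν (-x)) (𝓝[<] 1) (𝓝 0) := by
  obtain ⟨K, hK0, hK⟩ := exists_norm_mul_legendreCoeff_le ‖ν‖
  have hc : Tendsto (fun x : ℝ => 2 * K * (1 + 4 * K) * ((1 - x) / 2) ^ (3 / 4 : ℝ)) (𝓝[<] 1)
      (𝓝 0) := by
    have : Continuous fun x : ℝ => 2 * K * (1 + 4 * K) * ((1 - x) / 2) ^ (3 / 4 : ℝ) :=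
      continuous_const.mul (Continuous.rpow_const (by fun_prop) fun _ => Or.inr (by norm_num))
    have h := (this.tendsto 1).mono_left (nhdsWithin_le_nhds (s := Iio 1))
    rwa [sub_self, zero_div, Real.zero_rpow (by norm_num), mul_zero] at h
  refine squeeze_zero_norm' ?_ hc
  filter_upwards [Ioo_mem_nhdsLT (show (-1 : ℝ) < 1 by norm_num)] with x hx
  exact norm_legendreMom_mul_legendreFun_neg_le (hK ν le_rfl) hx

/-- This limit measures the logarithmic singularity of P_ν at -1; through it sin(νπ) enters all
later constants. -/
theorem tendsto_legendreMom_neg_one (ν : ℂ) :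
    Tendsto (fun x : ℝ => legendreMom ν (-x)) (𝓝[<] 1)
      (𝓝 (2 * (Complex.sin (ν * Real.pi) / Real.pi))) := by
  have hm : Tendsto (fun x : ℝ => (1 + x) / 2) (𝓝[<] 1) (𝓝[<] 1) := by
    refine tendsto_nhdsWithin_iff.mpr ⟨?_, ?_⟩
    · have : Continuous fun x : ℝ => (1 + x) / 2 := by fun_prop
      have h := (this.tendsto 1).mono_left (nhdsWithin_le_nhds (s := Iio 1))
      norm_num at h
      exact h
    · filter_upwards [self_mem_nhdsWithin] with x (hx : x < 1)
      change (1 + x) / 2 < 1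
      linarith
  have h := ((tendsto_legendreFlux_one ν).comp hm).const_mul (-2)
  convert! h using 2
  · simp [legendreMom]
  · ring

theorem tendsto_ofReal_nhdsLT_one : Tendsto (fun x : ℝ => (x : ℂ)) (𝓝[<] 1) (𝓝 1) := by
  simpa using (Complex.continuous_ofReal.tendsto 1).mono_left (nhdsWithin_le_nhds (s := Iio 1))

theorem tendsto_legendreFun_one (ν : ℂ) :
    Tendsto (fun x : ℝ => legendreFun ν x) (𝓝[<] 1) (𝓝 1) := by
  have h := (continuousAt_legendreFun ν (z := 1) (by simp)).tendsto
  rw [legendreFun_one] at h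
  exact h.comp tendsto_ofReal_nhdsLT_one

theorem tendsto_legendreMom_one (ν : ℂ) :
    Tendsto (fun x : ℝ => legendreMom ν x) (𝓝[<] 1) (𝓝 0) := by
  have h := (hasDerivAt_legendreMom ν (z := 1) (by simp)).continuousAt.tendsto
  rw [legendreMom_one] at h
  exact h.comp tendsto_ofReal_nhdsLT_one

/-- The Wronskian of `P_ν(z)` and `P_ν(-z)`. -/
theorem legendre_wronskian (ν : ℂ) {z : ℂ} (hz : z ∈ legendreLens) :
    -(legendreFun ν z * legendreMom ν (-z)) - legendreFun ν (-z) * legendreMom ν z =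
      -(2 * (Complex.sin (ν * Real.pi) / Real.pi)) := by
  set W : ℂ → ℂ := fun z =>
    -(legendreFun ν z * legendreMom ν (-z)) - legendreFun ν (-z) * legendreMom ν z with hW
  have hd : ∀ z ∈ legendreLens, HasDerivAt W 0 z := by
    intro z hz
    have hp := one_sub_sq_ne_zero_of_mem_legendreLens hz
    convert! ((hasDerivAt_legendreFun ν hz.1 hp).mul (hasDerivAt_legendreMom_neg ν hz.2)).neg.sub
      ((hasDerivAt_legendreFun_neg ν hz.2 hp).mul (hasDerivAt_legendreMom ν hz.1)) using 1
    field_simp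
    ring
  have hconst : ∀ x ∈ Ioo (-1 : ℝ) 1, W x = W z := by
    intro x hx
    refine isOpen_legendreLens.is_const_of_deriv_eq_zero convex_legendreLens.isPreconnected
      (fun y hy => (hd y hy).differentiableAt.differentiableWithinAt)
      (fun y hy => (hd y hy).deriv) (ofReal_mem_legendreLens hx) hz
  -- The constant is evaluated at 1, where P_ν(x) → 1 and the second product vanishes.
  have hlim : Tendsto (fun x : ℝ => W x) (𝓝[<] 1)
      (𝓝 (-(1 * (2 * (Complex.sin (ν * Real.pi) / Real.pi))) - 0)) := by
    refine ((tendsto_legendreFun_one ν).mul (tendsto_legendreMom_neg_one ν)).neg.sub ?_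
    simp_rw [mul_comm (legendreFun ν _)]
    exact tendsto_legendreMom_mul_legendreFun_neg ν
  have hlim2 : Tendsto (fun x : ℝ => W x) (𝓝[<] 1) (𝓝 (W z)) := by
    refine tendsto_const_nhds.congr' ?_
    filter_upwards [Ioo_mem_nhdsLT (show (-1 : ℝ) < 1 by norm_num)] with x hx
    exact (hconst x hx).symm
  simpa using tendsto_nhds_unique hlim2 hlim

/-! ### The symmetric square system on (-1, 1), with endpoint bounds -/

/-- The product `P_ν(x) P_ν(-x)`. -/
noncomputable def legendreProd (ν : ℂ) (x : ℝ) : ℂ := legendreFun ν x * legendreFun ν (-x)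

/-- The function `(1 - x²) w'(x)` for `w(x) = P_ν(x) P_ν(-x)`. -/
noncomputable def legendreProdMom (ν : ℂ) (x : ℝ) : ℂ :=
  legendreMom ν x * legendreFun ν (-x) - legendreFun ν x * legendreMom ν (-x)

/-- The product of `(1 - x²) d/dx P_ν(x)` and `(1 - x²) d/dx P_ν(-x)`. -/
noncomputable def legendreMomProd (ν : ℂ) (x : ℝ) : ℂ := -(legendreMom ν x * legendreMom ν (-x))

theorem hasDerivAt_legendreProd (ν : ℂ) {x : ℝ} (hx : x ∈ Ioo (-1 : ℝ) 1) :
    HasDerivAt (legendreProd ν) (legendreProdMom ν x / (1 - (x : ℂ) ^ 2)) x := by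
  have hL := ofReal_mem_legendreLens hx
  have hp := one_sub_sq_ne_zero_of_mem_legendreLens hL
  convert! ((hasDerivAt_legendreFun ν hL.1 hp).mul
    (hasDerivAt_legendreFun_neg ν hL.2 hp)).comp_ofReal using 1
  rw [legendreProdMom]
  ring

/-- The derivative is displayed over 1 - x² so that `one_sub_sq_mul_deriv_cauchyTransform` applies
to this component exactly as it does to w. -/
theorem hasDerivAt_legendreProdMom (ν : ℂ) {x : ℝ} (hx : x ∈ Ioo (-1 : ℝ) 1) :
    HasDerivAt (legendreProdMom ν) ((-(2 * (ν * (ν + 1))) * ((1 - (x : ℂ) ^ 2) * legendreProd ν x) +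
      2 * legendreMomProd ν x) / (1 - (x : ℂ) ^ 2)) x := by
  have hL := ofReal_mem_legendreLens hx
  have hp := one_sub_sq_ne_zero_of_mem_legendreLens hL
  convert! (((hasDerivAt_legendreMom ν hL.1).mul (hasDerivAt_legendreFun_neg ν hL.2 hp)).sub
    ((hasDerivAt_legendreFun ν hL.1 hp).mul (hasDerivAt_legendreMom_neg ν hL.2))).comp_ofReal using 1
  rw [legendreProd, legendreMomProd]
  field_simp
  ring

theorem hasDerivAt_legendreMomProd (ν : ℂ) {x : ℝ} (hx : x ∈ Ioo (-1 : ℝ) 1) :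
    HasDerivAt (legendreMomProd ν) (-(ν * (ν + 1)) * legendreProdMom ν x) x := by
  have hL := ofReal_mem_legendreLens hx
  convert! ((hasDerivAt_legendreMom ν hL.1).mul
    (hasDerivAt_legendreMom_neg ν hL.2)).neg.comp_ofReal using 1
  rw [legendreProdMom]
  ring

theorem legendreProd_neg (ν : ℂ) (x : ℝ) : legendreProd ν (-x) = legendreProd ν x := by
  simp [legendreProd, mul_comm]

theorem legendreProdMom_neg (ν : ℂ) (x : ℝ) : legendreProdMom ν (-x) = -legendreProdMom ν x := by
  simp [legendreProdMom, mul_comm]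

theorem legendreMomProd_neg (ν : ℂ) (x : ℝ) : legendreMomProd ν (-x) = legendreMomProd ν x := by
  simp [legendreMomProd, mul_comm]

/-- An integrable function on `(-1, 1)` that dominates `P_ν(x) P_ν(-x)`. -/
noncomputable def endpointBound (x : ℝ) : ℝ :=
  ((1 + x) / 2) ^ (-(1 / 2) : ℝ) + ((1 - x) / 2) ^ (-(1 / 2) : ℝ)

theorem integrableOn_endpointBound : IntegrableOn endpointBound (Ioo (-1 : ℝ) 1) := by
  rw [← intervalIntegrable_iff_integrableOn_Ioo_of_le (by norm_num)]
  have h : IntervalIntegrable (fun x : ℝ => x ^ (-(1 / 2) : ℝ)) volume 0 1 :=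
    intervalIntegral.intervalIntegrable_rpow' (by norm_num)
  have h1 := (h.comp_mul_left (c := 1 / 2)).comp_add_right 1
  have h2 := (h.comp_mul_left (c := 1 / 2)).comp_sub_left 1
  norm_num at h1 h2
  convert! h1.add h2.symm using 1
  ext x
  simp only [endpointBound]
  ring_nf

theorem norm_legendreProd_le {ν : ℂ} {K : ℝ} (hK : ∀ n : ℕ, ‖(n : ℂ) * legendreCoeff ν n‖ ≤ K)
    {x : ℝ} (hx : x ∈ Ioo (-1 : ℝ) 1) :
    ‖legendreProd ν x‖ ≤ (1 + 4 * K) ^ 2 * endpointBound x := by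
  have hK0 : 0 ≤ K := (norm_nonneg _).trans (hK 0)
  have ha : 0 < (1 + x) / 2 := by linarith [hx.1]
  have hb : 0 < (1 - x) / 2 := by linarith [hx.2]
  have hsq : ∀ y : ℝ, 0 < y → y ^ (-(1 / 2) : ℝ) = (y ^ (-(1 / 4) : ℝ)) ^ 2 := fun y hy => by
    rw [← Real.rpow_natCast, ← Real.rpow_mul hy.le]
    norm_num
  have h := mul_le_mul (norm_legendreFun_le hK hx) (norm_legendreFun_neg_le hK hx) (norm_nonneg _)
    (by positivity)
  rw [legendreProd, norm_mul]
  refine h.trans ?_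
  rw [endpointBound, hsq _ ha, hsq _ hb]
  set a := ((1 + x) / 2) ^ (-(1 / 4) : ℝ)
  set b := ((1 - x) / 2) ^ (-(1 / 4) : ℝ)
  have hab : a * b ≤ a ^ 2 + b ^ 2 := by nlinarith [sq_nonneg (a - b), sq_nonneg (a + b)]
  calc _ = (1 + 4 * K) ^ 2 * (a * b) := by ring
    _ ≤ _ := by gcongr

theorem norm_legendreProdMom_le {ν : ℂ} {K : ℝ} (hK : ∀ n : ℕ, ‖(n : ℂ) * legendreCoeff ν n‖ ≤ K)
    {x : ℝ} (hx : x ∈ Ioo (-1 : ℝ) 1) :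
    ‖legendreProdMom ν x‖ ≤ 4 * K * (1 + 4 * K) := by
  have hK0 : 0 ≤ K := (norm_nonneg _).trans (hK 0)
  have key : ∀ x ∈ Ioo (-1 : ℝ) 1,
      ‖legendreMom ν x * legendreFun ν (-x)‖ ≤ 2 * K * (1 + 4 * K) := by
    intro x hx
    refine (norm_legendreMom_mul_legendreFun_neg_le hK hx).trans ?_
    have : ((1 - x) / 2) ^ (3 / 4 : ℝ) ≤ 1 :=
      Real.rpow_le_one (by linarith [hx.2]) (by linarith [hx.1]) (by norm_num)
    have h0 : 0 ≤ 2 * K * (1 + 4 * K) := by positivity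
    nlinarith
  have h1 := key x hx
  have h2 := key (-x) (neg_mem_Ioo_one hx)
  push_cast at h2
  rw [neg_neg, mul_comm] at h2
  refine (norm_sub_le _ _).trans ?_
  linarith

theorem norm_legendreMomProd_le {ν : ℂ} {K : ℝ} (hK : ∀ n : ℕ, ‖(n : ℂ) * legendreCoeff ν n‖ ≤ K)
    {x : ℝ} (hx : x ∈ Ioo (-1 : ℝ) 1) :
    ‖legendreMomProd ν x‖ ≤ K ^ 2 * (1 - x ^ 2) := by
  have hK0 : 0 ≤ K := (norm_nonneg _).trans (hK 0)
  rw [legendreMomProd, norm_neg, norm_mul]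
  calc _ ≤ (K * (1 - x)) * (K * (1 + x)) :=
        mul_le_mul (norm_legendreMom_le hK hx) (norm_legendreMom_neg_le hK hx) (norm_nonneg _)
          (mul_nonneg hK0 (by linarith [hx.2]))
    _ = _ := by ring

theorem integrableOn_Ioo_of_hasDerivAt_of_norm_le {g g' : ℝ → ℂ} {φ : ℝ → ℝ}
    (hg : ∀ x ∈ Ioo (-1 : ℝ) 1, HasDerivAt g (g' x) x) (hφ : IntegrableOn φ (Ioo (-1 : ℝ) 1))
    (hb : ∀ x ∈ Ioo (-1 : ℝ) 1, ‖g x‖ ≤ φ x) : IntegrableOn g (Ioo (-1 : ℝ) 1) := by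
  have hc : ContinuousOn g (Ioo (-1 : ℝ) 1) := fun x hx => (hg x hx).continuousAt.continuousWithinAt
  refine Integrable.mono' hφ (hc.aestronglyMeasurable measurableSet_Ioo) ?_
  filter_upwards [ae_restrict_mem measurableSet_Ioo] with x hx using hb x hx

theorem integrableOn_legendreProd (ν : ℂ) : IntegrableOn (legendreProd ν) (Ioo (-1 : ℝ) 1) := by
  obtain ⟨K, hK0, hK⟩ := exists_norm_mul_legendreCoeff_le ‖ν‖
  exact integrableOn_Ioo_of_hasDerivAt_of_norm_le (fun x hx => hasDerivAt_legendreProd ν hx)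
    (integrableOn_endpointBound.const_mul _) (fun x hx => norm_legendreProd_le (hK ν le_rfl) hx)

theorem integrableOn_legendreProdMom (ν : ℂ) :
    IntegrableOn (legendreProdMom ν) (Ioo (-1 : ℝ) 1) := by
  obtain ⟨K, hK0, hK⟩ := exists_norm_mul_legendreCoeff_le ‖ν‖
  exact integrableOn_Ioo_of_hasDerivAt_of_norm_le (fun x hx => hasDerivAt_legendreProdMom ν hx)
    (integrableOn_const (by simp)) (fun x hx => norm_legendreProdMom_le (hK ν le_rfl) hx)

theorem integrableOn_legendreMomProd (ν : ℂ) :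
    IntegrableOn (legendreMomProd ν) (Ioo (-1 : ℝ) 1) := by
  obtain ⟨K, hK0, hK⟩ := exists_norm_mul_legendreCoeff_le ‖ν‖
  refine integrableOn_Ioo_of_hasDerivAt_of_norm_le (fun x hx => hasDerivAt_legendreMomProd ν hx)
    (integrableOn_const (C := K ^ 2) (by simp))
    (fun x hx => (norm_legendreMomProd_le (hK ν le_rfl) hx).trans ?_)
  nlinarith [sq_nonneg K, sq_nonneg x, mul_nonneg (sq_nonneg K) (sq_nonneg x)]

theorem integrableOn_legendreMomProd_div (ν : ℂ) :
    IntegrableOn (fun x : ℝ => legendreMomProd ν x / (1 - (x : ℂ) ^ 2)) (Ioo (-1 : ℝ) 1) := by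
  obtain ⟨K, hK0, hK⟩ := exists_norm_mul_legendreCoeff_le ‖ν‖
  refine integrableOn_Ioo_of_hasDerivAt_of_norm_le 
    (g' := deriv fun x : ℝ => legendreMomProd ν x / (1 - (x : ℂ) ^ 2)) (fun x hx => ?_)
    (integrableOn_const (C := K ^ 2) (by simp)) (fun x hx => ?_)
  · have hp := one_sub_sq_ne_zero_of_mem_legendreLens (ofReal_mem_legendreLens hx)
    refine DifferentiableAt.hasDerivAt ?_
    refine (hasDerivAt_legendreMomProd ν hx).differentiableAt.div ?_ hp
    exact ((Complex.ofRealCLM.differentiableAt (x := x)).pow 2).const_sub 1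
  · have hpos : 0 < 1 - x ^ 2 := by nlinarith [hx.1, hx.2]
    have e : ‖1 - (x : ℂ) ^ 2‖ = 1 - x ^ 2 := by
      rw [← Complex.ofReal_one, ← Complex.ofReal_pow, ← Complex.ofReal_sub, Complex.norm_real,
        Real.norm_of_nonneg hpos.le]
    rw [norm_div, e, div_le_iff₀ hpos]
    exact norm_legendreMomProd_le (hK ν le_rfl) hx

theorem tendsto_nhdsGT_neg_one_of_nhdsLT_one {f : ℝ → ℂ} {l : ℂ}
    (h : Tendsto f (𝓝[<] 1) (𝓝 l)) : Tendsto (fun x => f (-x)) (𝓝[>] (-1)) (𝓝 l) :=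
  h.comp tendsto_neg_nhdsGT_neg

theorem tendsto_one_sub_mul_legendreFun_neg (ν : ℂ) :
    Tendsto (fun x : ℝ => (1 - (x : ℂ)) * legendreFun ν (-x)) (𝓝[<] 1) (𝓝 0) := by
  obtain ⟨K, hK0, hK⟩ := exists_norm_mul_legendreCoeff_le ‖ν‖
  have hc : Tendsto (fun x : ℝ => 2 * (1 + 4 * K) * ((1 - x) / 2) ^ (3 / 4 : ℝ)) (𝓝[<] 1)
      (𝓝 0) := by
    have : Continuous fun x : ℝ => 2 * (1 + 4 * K) * ((1 - x) / 2) ^ (3 / 4 : ℝ) :=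
      continuous_const.mul (Continuous.rpow_const (by fun_prop) fun _ => Or.inr (by norm_num))
    have h := (this.tendsto 1).mono_left (nhdsWithin_le_nhds (s := Iio 1))
    rwa [sub_self, zero_div, Real.zero_rpow (by norm_num), mul_zero] at h
  refine squeeze_zero_norm' ?_ hc
  filter_upwards [Ioo_mem_nhdsLT (show (-1 : ℝ) < 1 by norm_num)] with x hx
  have hy : 0 < (1 - x) / 2 := by linarith [hx.2]
  rw [← mul_rpow_neg_quarter hy, norm_mul, ← Complex.ofReal_one, ← Complex.ofReal_sub,
    Complex.norm_real, Real.norm_of_nonneg (by linarith)]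
  calc _ ≤ (1 - x) * ((1 + 4 * K) * ((1 - x) / 2) ^ (-(1 / 4) : ℝ)) := by
        gcongr
        · linarith
        · exact norm_legendreFun_neg_le (hK ν le_rfl) hx
    _ = _ := by ring

theorem tendsto_one_sub_sq_mul_legendreProd_one (ν : ℂ) :
    Tendsto (fun x : ℝ => (1 - (x : ℂ) ^ 2) * legendreProd ν x) (𝓝[<] 1) (𝓝 0) := by
  have h := ((tendsto_ofReal_nhdsLT_one.const_add 1).mul (tendsto_legendreFun_one ν)).mul
    (tendsto_one_sub_mul_legendreFun_neg ν)
  rw [mul_zero] at h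
  refine h.congr fun x => ?_
  rw [legendreProd]
  ring

theorem tendsto_one_sub_sq_mul_legendreProdMom_one (ν : ℂ) :
    Tendsto (fun x : ℝ => (1 - (x : ℂ) ^ 2) * legendreProdMom ν x) (𝓝[<] 1) (𝓝 0) := by
  have h := ((tendsto_ofReal_nhdsLT_one.pow 2).const_sub 1).mul
    ((tendsto_legendreMom_mul_legendreFun_neg ν).sub
      ((tendsto_legendreFun_one ν).mul (tendsto_legendreMom_neg_one ν)))
  rwa [one_pow, sub_self, zero_mul] at h

theorem tendsto_legendreMomProd_one (ν : ℂ) :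
    Tendsto (legendreMomProd ν) (𝓝[<] 1) (𝓝 0) := by
  have h := ((tendsto_legendreMom_one ν).mul (tendsto_legendreMom_neg_one ν)).neg
  rwa [zero_mul, neg_zero] at h

theorem tendsto_one_sub_sq_mul_legendreProd_neg_one (ν : ℂ) :
    Tendsto (fun x : ℝ => (1 - (x : ℂ) ^ 2) * legendreProd ν x) (𝓝[>] (-1)) (𝓝 0) := by
  simpa [legendreProd_neg] using
    tendsto_nhdsGT_neg_one_of_nhdsLT_one (tendsto_one_sub_sq_mul_legendreProd_one ν)

theorem tendsto_one_sub_sq_mul_legendreProdMom_neg_one (ν : ℂ) :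
    Tendsto (fun x : ℝ => (1 - (x : ℂ) ^ 2) * legendreProdMom ν x) (𝓝[>] (-1)) (𝓝 0) := by
  simpa [legendreProdMom_neg] using
    (tendsto_nhdsGT_neg_one_of_nhdsLT_one (tendsto_one_sub_sq_mul_legendreProdMom_one ν)).neg

theorem tendsto_legendreMomProd_neg_one (ν : ℂ) :
    Tendsto (legendreMomProd ν) (𝓝[>] (-1)) (𝓝 0) := by
  simpa [legendreMomProd_neg] using
    tendsto_nhdsGT_neg_one_of_nhdsLT_one (tendsto_legendreMomProd_one ν)

/-- The integrand is the derivative of minus P_ν(x) times the flux value `legendreMom ν (-x)`, so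
only its limit at 1 survives. This identity fixes the endpoint values of the first integrals. -/
theorem integral_legendreMomProd_div_sub (ν : ℂ) :
    (∫ x in Ioo (-1 : ℝ) 1, legendreMomProd ν x / (1 - (x : ℂ) ^ 2)) -
      ν * (ν + 1) * ∫ x in Ioo (-1 : ℝ) 1, legendreProd ν x =
        -(2 * (Complex.sin (ν * Real.pi) / Real.pi)) := by
  rw [← integral_const_mul, ← integral_sub (integrableOn_legendreMomProd_div ν)
    ((integrableOn_legendreProd ν).const_mul _)]
  rw [integral_Ioo_eq_sub_of_hasDerivAt (F := fun x : ℝ => -(legendreFun ν x * legendreMom ν (-x)))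
    (A := 0) (B := -(2 * (Complex.sin (ν * Real.pi) / Real.pi)))]
  · ring
  · intro x hx
    have hL := ofReal_mem_legendreLens hx
    have hp := one_sub_sq_ne_zero_of_mem_legendreLens hL
    convert! ((hasDerivAt_legendreFun ν hL.1 hp).mul
      (hasDerivAt_legendreMom_neg ν hL.2)).neg.comp_ofReal using 1
    rw [legendreProd, legendreMomProd]
    ring
  · exact (integrableOn_legendreMomProd_div ν).sub ((integrableOn_legendreProd ν).const_mul _)
  · have := (tendsto_nhdsGT_neg_one_of_nhdsLT_one (tendsto_legendreMom_mul_legendreFun_neg ν)).neg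
    simpa [mul_comm] using this
  · simpa using ((tendsto_legendreFun_one ν).mul (tendsto_legendreMom_neg_one ν)).neg

theorem ofReal_sub_ne_zero_of_abs_eq_one {σ x : ℝ} (hσ : |σ| = 1) (hx : x ∈ Ioo (-1 : ℝ) 1) :
    (σ : ℂ) - x ≠ 0 := by
  rw [← Complex.ofReal_sub]
  exact_mod_cast abs_pos.mp (abs_ofReal_sub_pos hσ hx)

theorem ofReal_sq_eq_one {σ : ℝ} (hσ : |σ| = 1) : (σ : ℂ) ^ 2 = 1 := by
  rw [← Complex.ofReal_pow, ← sq_abs, hσ]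
  simp

/-- Since σ² = 1, 1/(σ-x) = (σ+x)/(1-x²). After integration only the even part σ/(1-x²) contributes.
-/
theorem legendreMomProd_div_sub_eq {ν : ℂ} {σ x : ℝ} (hσ : |σ| = 1) (hx : x ∈ Ioo (-1 : ℝ) 1) :
    legendreMomProd ν x / ((σ : ℂ) - x) = (σ : ℂ) * (legendreMomProd ν x / (1 - (x : ℂ) ^ 2)) +
      (x : ℂ) * (legendreMomProd ν x / (1 - (x : ℂ) ^ 2)) := by
  have hp := one_sub_sq_ne_zero_of_mem_legendreLens (ofReal_mem_legendreLens hx)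
  have hs := ofReal_sub_ne_zero_of_abs_eq_one hσ hx
  have h2 := ofReal_sq_eq_one hσ
  field_simp
  linear_combination -legendreMomProd ν x * h2

theorem integrableOn_legendreMomProd_div_sub (ν : ℂ) {σ : ℝ} (hσ : |σ| = 1) :
    IntegrableOn (fun x : ℝ => legendreMomProd ν x / ((σ : ℂ) - x)) (Ioo (-1 : ℝ) 1) := by
  have h := (integrableOn_legendreMomProd_div ν)
  refine IntegrableOn.congr_fun ((h.const_mul (σ : ℂ)).add (integrableOn_bdd_mul h
    (φ := fun x : ℝ => (x : ℂ)) (by fun_prop))) ?_ measurableSet_Ioo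
  intro x hx
  exact (legendreMomProd_div_sub_eq hσ hx).symm

theorem integral_legendreMomProd_div_endpoint_sub (ν : ℂ) {σ : ℝ} (hσ : |σ| = 1) :
    ∫ x in Ioo (-1 : ℝ) 1, legendreMomProd ν x / ((σ : ℂ) - x) =
      σ * ∫ x in Ioo (-1 : ℝ) 1, legendreMomProd ν x / (1 - (x : ℂ) ^ 2) := by
  have h := (integrableOn_legendreMomProd_div ν)
  rw [setIntegral_congr_fun measurableSet_Ioo fun x hx => legendreMomProd_div_sub_eq hσ hx,
    integral_add (h.const_mul _) (integrableOn_bdd_mul h (φ := fun x : ℝ => (x : ℂ)) (by fun_prop)),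
    integral_const_mul, add_eq_left]
  refine integral_Ioo_eq_zero_of_odd fun x hx => ?_
  rw [legendreMomProd_neg]
  push_cast
  rw [neg_sq]
  ring

/-! ### The same system for the Cauchy transforms -/

/-- The Cauchy transform of `(1 - x²) w'(x)`, `w(x) = P_ν(x) P_ν(-x)`, plus the mass of `w`. -/
noncomputable def legendreTransformMom (ν z : ℂ) : ℂ :=
  cauchyTransform (legendreProdMom ν) z + ∫ ξ in Ioo (-1 : ℝ) 1, legendreProd ν ξ

/-- The Cauchy transform of the product of the two flux functions, with a linear correction. -/
noncomputable def legendreTransformMomProd (ν z : ℂ) : ℂ :=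
  cauchyTransform (legendreMomProd ν) z -
    ν * (ν + 1) * z * ∫ ξ in Ioo (-1 : ℝ) 1, legendreProd ν ξ

theorem one_sub_sq_ne_zero_of_im_pos {z : ℂ} (hz : 0 < z.im) : 1 - z ^ 2 ≠ 0 := by
  intro h
  rw [show 1 - z ^ 2 = (1 - z) * (1 + z) by ring, mul_eq_zero] at h
  rcases h with h | h
  · rw [← sub_eq_zero.mp h] at hz
    simp at hz
  · rw [eq_neg_of_add_eq_zero_right h] at hz
    simp at hz

theorem integral_legendreProdMom (ν : ℂ) : ∫ ξ in Ioo (-1 : ℝ) 1, legendreProdMom ν ξ = 0 :=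
  integral_Ioo_eq_zero_of_odd fun x _ => legendreProdMom_neg ν x

theorem hasDerivAt_cauchyTransform_legendreProd (ν : ℂ) {z : ℂ} (hz : 0 < z.im) :
    HasDerivAt (cauchyTransform (legendreProd ν)) (legendreTransformMom ν z / (1 - z ^ 2)) z := by
  convert! hasDerivAt_cauchyTransform (integrableOn_legendreProd ν) hz using 1
  rw [div_eq_iff (one_sub_sq_ne_zero_of_im_pos hz), mul_comm, legendreTransformMom]
  exact (one_sub_sq_mul_deriv_cauchyTransform (fun x hx => hasDerivAt_legendreProd ν hx)
    (integrableOn_legendreProd ν) (integrableOn_legendreProdMom ν)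
    (tendsto_one_sub_sq_mul_legendreProd_neg_one ν)
    (tendsto_one_sub_sq_mul_legendreProd_one ν) hz).symm

/-- The flux of w is odd, so it contributes no mass term. The extra z·∫w from transforming (1-ξ²)w
is exactly what the linear correction in the third component absorbs. -/
theorem hasDerivAt_legendreTransformMom (ν : ℂ) {z : ℂ} (hz : 0 < z.im) :
    HasDerivAt (legendreTransformMom ν)
      (-(2 * (ν * (ν + 1))) * cauchyTransform (legendreProd ν) z +
        2 * legendreTransformMomProd ν z / (1 - z ^ 2)) z := by
  have hpw : IntegrableOn (fun ξ : ℝ => (1 - (ξ : ℂ) ^ 2) * legendreProd ν ξ) (Ioo (-1 : ℝ) 1) :=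
    integrableOn_bdd_mul (integrableOn_legendreProd ν) (by fun_prop)
  have hq := integrableOn_legendreMomProd ν
  have h1 := (hpw.const_mul (-(2 * (ν * (ν + 1))))).add (hq.const_mul 2)
  have key := one_sub_sq_mul_deriv_cauchyTransform (fun x hx => hasDerivAt_legendreProdMom ν hx)
    (integrableOn_legendreProdMom ν) h1 (tendsto_one_sub_sq_mul_legendreProdMom_neg_one ν)
    (tendsto_one_sub_sq_mul_legendreProdMom_one ν) hz
  have e : cauchyTransform (fun x : ℝ => -(2 * (ν * (ν + 1))) *
      ((1 - (x : ℂ) ^ 2) * legendreProd ν x) + 2 * legendreMomProd ν x) z =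
      -(2 * (ν * (ν + 1))) * cauchyTransform (fun x : ℝ => (1 - (x : ℂ) ^ 2) * legendreProd ν x) z +
        2 * cauchyTransform (legendreMomProd ν) z := by
    unfold cauchyTransform
    rw [← integral_const_mul, ← integral_const_mul, ← integral_add
      ((integrableOn_div_sub_ofReal hpw hz).const_mul _)
      ((integrableOn_div_sub_ofReal hq hz).const_mul _)]
    congr 1 with ξ
    ring
  rw [integral_legendreProdMom, e, cauchyTransform_one_sub_sq_mul (integrableOn_legendreProd ν)
    (fun x _ => legendreProd_neg ν x) hz] at key
  have hp := one_sub_sq_ne_zero_of_im_pos hz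
  convert! (hasDerivAt_cauchyTransform (integrableOn_legendreProdMom ν) hz).add_const _ using 1
  rw [← mul_right_inj' hp, key, legendreTransformMomProd]
  field_simp
  ring

theorem hasDerivAt_legendreTransformMomProd (ν : ℂ) {z : ℂ} (hz : 0 < z.im) :
    HasDerivAt (legendreTransformMomProd ν)
      (-(ν * (ν + 1)) * legendreTransformMom ν z) z := by
  have h1 := (integrableOn_legendreProdMom ν).const_mul (-(ν * (ν + 1)))
  have key := integral_div_sub_sq_eq_neg (fun x hx => hasDerivAt_legendreMomProd ν hx)
    (integrableOn_legendreMomProd ν) h1 (tendsto_legendreMomProd_neg_one ν)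
    (tendsto_legendreMomProd_one ν) hz
  have e : cauchyTransform (fun x : ℝ => -(ν * (ν + 1)) * legendreProdMom ν x) z =
      -(ν * (ν + 1)) * cauchyTransform (legendreProdMom ν) z := by
    unfold cauchyTransform
    rw [← integral_const_mul]
    congr 1 with ξ
    ring
  have hd := (hasDerivAt_cauchyTransform (integrableOn_legendreMomProd ν) hz).sub
    (((hasDerivAt_id z).const_mul (ν * (ν + 1))).mul_const
      (∫ ξ in Ioo (-1 : ℝ) 1, legendreProd ν ξ))
  convert! hd using 1
  rw [key, e, legendreTransformMom]
  ring

/-! ### Quadratic first integrals and their endpoint values -/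

theorem cornerPoint_mem_legendreLens {σ δ : ℝ} (hσ : |σ| = 1) (hδ : δ ∈ Ioo (0 : ℝ) 1) :
    cornerPoint σ δ ∈ legendreLens := by
  have h1 : ∀ τ : ℝ, |τ| = 1 → (1 + τ * (1 - δ)) ^ 2 + δ ^ 2 < 4 := by
    intro τ hτ
    have h2 := abs_le.mp hτ.le
    have ht : τ ^ 2 = 1 := by rw [← sq_abs, hτ, one_pow]
    nlinarith [hδ.1, hδ.2, mul_nonneg (sub_nonneg.mpr h2.2) (sub_pos.mpr hδ.2).le]
  have key : ∀ w : ℂ, w.re ^ 2 + w.im ^ 2 < 4 → ‖w‖ < 2 := by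
    intro w hw
    rw [← abs_of_nonneg (norm_nonneg w), ← abs_of_pos (two_pos (α := ℝ)), ← sq_lt_sq, Complex.sq_norm,
      Complex.normSq_apply]
    nlinarith
  refine ⟨key _ ?_, key _ ?_⟩
  · have := h1 (-σ) (by rwa [abs_neg])
    simp [cornerPoint]
    nlinarith
  · have := h1 σ hσ
    simpa [cornerPoint] using this

/-- The flux of `P_ν` vanishes linearly at the end point `1`. -/
theorem tendsto_inv_mul_legendreMom_cornerPoint (ν : ℂ) {σ : ℝ} (hσ : |σ| = 1) :
    ∃ D : ℂ, Tendsto (fun δ : ℝ => (δ : ℂ)⁻¹ * legendreMom ν (σ * cornerPoint σ δ)) (𝓝[>] 0)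
      (𝓝 D) := by
  have h2 := ofReal_sq_eq_one hσ
  have e : ∀ δ : ℝ, (σ : ℂ) * cornerPoint σ δ = 1 - δ + σ * δ * Complex.I := by
    intro δ
    have : cornerPoint σ δ = σ * (1 - δ) + δ * Complex.I := by
      apply Complex.ext <;> simp [cornerPoint]
    rw [this]
    linear_combination (1 - (δ : ℂ)) * h2
  have hm := hasDerivAt_legendreMom ν (z := 1) (by simp)
  have hc : HasDerivAt (fun w : ℂ => 1 - w + σ * w * Complex.I) (-1 + σ * Complex.I) 0 := by
    convert! ((hasDerivAt_id (0 : ℂ)).const_sub 1).add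
      (((hasDerivAt_id (0 : ℂ)).const_mul (σ : ℂ)).mul_const Complex.I) using 1
    simp
  have h := (HasDerivAt.comp (h₂ := legendreMom ν) (0 : ℂ) (by simpa using hm) hc)
  have h' := (HasDerivAt.comp_ofReal (z := 0) (by simpa using h)).tendsto_slope_zero_right
  refine ⟨_, h'.congr fun δ => ?_⟩
  simp [e, legendreMom_one]

theorem tendsto_legendreTransformMomProd_cornerPoint (ν : ℂ) {σ : ℝ} (hσ : |σ| = 1) :
    Tendsto (fun δ : ℝ => legendreTransformMomProd ν (cornerPoint σ δ)) (𝓝[>] 0)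
      (𝓝 (-(σ * (2 * (Complex.sin (ν * Real.pi) / Real.pi))))) := by
  have h := (tendsto_cauchyTransform_cornerPoint hσ (integrableOn_legendreMomProd ν)
    (integrableOn_legendreMomProd_div_sub ν hσ)).sub
    (((tendsto_cornerPoint σ).const_mul (ν * (ν + 1))).mul_const
      (∫ ξ in Ioo (-1 : ℝ) 1, legendreProd ν ξ))
  convert! h using 2
  rw [integral_legendreMomProd_div_endpoint_sub ν hσ]
  linear_combination -(σ : ℂ) * integral_legendreMomProd_div_sub ν

theorem tendsto_mul_legendreTransformMom_cornerPoint (ν : ℂ) {σ : ℝ} (hσ : |σ| = 1) :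
    Tendsto (fun δ : ℝ => (δ : ℂ) * legendreTransformMom ν (cornerPoint σ δ)) (𝓝[>] 0) (𝓝 0) := by
  have h0 : Tendsto (fun δ : ℝ => (δ : ℂ)) (𝓝[>] 0) (𝓝 0) := by
    simpa using (Complex.continuous_ofReal.tendsto 0).mono_left nhdsWithin_le_nhds
  have h := (tendsto_mul_cauchyTransform_cornerPoint hσ (integrableOn_legendreProdMom ν)).add
    (h0.mul_const (∫ ξ in Ioo (-1 : ℝ) 1, legendreProd ν ξ))
  simp only [zero_mul, add_zero] at h
  refine h.congr fun δ => ?_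
  rw [legendreTransformMom]
  ring

/-- The value at an end point of the quadratic first integral. -/
theorem tendsto_firstIntegral_cornerPoint (ν : ℂ) {σ : ℝ} (hσ : |σ| = 1) :
    Tendsto (fun δ : ℝ =>
      legendreMom ν (σ * cornerPoint σ δ) ^ 2 * cauchyTransform (legendreProd ν) (cornerPoint σ δ) -
      σ * (legendreFun ν (σ * cornerPoint σ δ) * legendreMom ν (σ * cornerPoint σ δ) *
        legendreTransformMom ν (cornerPoint σ δ)) +
      legendreFun ν (σ * cornerPoint σ δ) ^ 2 * legendreTransformMomProd ν (cornerPoint σ δ))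
      (𝓝[>] 0) (𝓝 (-(σ * (2 * (Complex.sin (ν * Real.pi) / Real.pi))))) := by
  obtain ⟨D, hD⟩ := tendsto_inv_mul_legendreMom_cornerPoint ν hσ
  have hz : Tendsto (fun δ : ℝ => (σ : ℂ) * cornerPoint σ δ) (𝓝[>] 0) (𝓝 1) := by
    have := (tendsto_cornerPoint σ).const_mul (σ : ℂ)
    rwa [← sq, ofReal_sq_eq_one hσ] at this
  have hu := (continuousAt_legendreFun ν (z := 1) (by simp)).tendsto.comp hz
  have hU := (hasDerivAt_legendreMom ν (z := 1) (by simp)).continuousAt.tendsto.comp hz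
  rw [legendreFun_one] at hu
  rw [legendreMom_one] at hU
  -- Powers of δ are redistributed: one flux factor is divided by δ and converges, while δ times
  -- each possibly singular transform tends to 0. Only the third component contributes in the limit.
  have h1 := (hD.mul hU).mul
    (tendsto_mul_cauchyTransform_cornerPoint hσ (integrableOn_legendreProd ν))
  have h2 := ((hu.mul hD).mul (tendsto_mul_legendreTransformMom_cornerPoint ν hσ)).const_mul (σ : ℂ)
  have h3 := (hu.pow 2).mul (tendsto_legendreTransformMomProd_cornerPoint ν hσ)
  have h := (h1.sub h2).add h3
  simp only [mul_zero, sub_zero, zero_add, one_pow, one_mul] at h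
  refine h.congr' ?_
  filter_upwards [self_mem_nhdsWithin] with δ (hδ : 0 < δ)
  have hne : (δ : ℂ) ≠ 0 := by exact_mod_cast hδ.ne'
  simp only [Function.comp_apply]
  field_simp

theorem isOpen_upperLens : IsOpen (legendreLens ∩ {z | 0 < z.im}) :=
  isOpen_legendreLens.inter (isOpen_lt continuous_const Complex.continuous_im)

theorem convex_upperLens : Convex ℝ (legendreLens ∩ {z | 0 < z.im}) :=
  convex_legendreLens.inter (convex_halfSpace_im_gt 0)

theorem eq_of_hasDerivAt_zero_upperLens {f : ℂ → ℂ}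
    (hf : ∀ z ∈ legendreLens ∩ {z | 0 < z.im}, HasDerivAt f 0 z) {z w : ℂ}
    (hz : z ∈ legendreLens ∩ {z | 0 < z.im}) (hw : w ∈ legendreLens ∩ {z | 0 < z.im}) :
    f z = f w :=
  isOpen_upperLens.is_const_of_deriv_eq_zero convex_upperLens.isPreconnected
    (fun y hy => (hf y hy).differentiableAt.differentiableWithinAt)
    (fun y hy => (hf y hy).deriv) hz hw

theorem cornerPoint_mem_upperLens {σ : ℝ} (hσ : |σ| = 1) :
    ∀ᶠ δ in 𝓝[>] (0 : ℝ), cornerPoint σ δ ∈ legendreLens ∩ {z | 0 < z.im} := by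
  filter_upwards [Ioo_mem_nhdsGT (zero_lt_one (α := ℝ))] with δ hδ
  exact ⟨cornerPoint_mem_legendreLens hσ hδ, hδ.1⟩

/-- This is the invariant pairing of the transformed system with u². It is evaluated at z = 1, where
u = 1 and its flux vanishes. -/
theorem firstIntegral_right (ν : ℂ) {z : ℂ} (hz : z ∈ legendreLens ∩ {z | 0 < z.im}) :
    legendreMom ν z ^ 2 * cauchyTransform (legendreProd ν) z -
      legendreFun ν z * legendreMom ν z * legendreTransformMom ν z +
      legendreFun ν z ^ 2 * legendreTransformMomProd ν z =
        -(2 * (Complex.sin (ν * Real.pi) / Real.pi)) := by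
  set f : ℂ → ℂ := fun z => legendreMom ν z ^ 2 * cauchyTransform (legendreProd ν) z -
    legendreFun ν z * legendreMom ν z * legendreTransformMom ν z +
    legendreFun ν z ^ 2 * legendreTransformMomProd ν z with hf
  have hd : ∀ z ∈ legendreLens ∩ {z | 0 < z.im}, HasDerivAt f 0 z := by
    rintro z ⟨hL, hz⟩
    have hp := one_sub_sq_ne_zero_of_mem_legendreLens hL
    have hu := hasDerivAt_legendreFun ν hL.1 hp
    have hU := hasDerivAt_legendreMom ν hL.1
    convert! (((hU.pow 2).mul (hasDerivAt_cauchyTransform_legendreProd ν hz)).sub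
      ((hu.mul hU).mul (hasDerivAt_legendreTransformMom ν hz))).add
      ((hu.pow 2).mul (hasDerivAt_legendreTransformMomProd ν hz)) using 1
    simp only [Pi.mul_apply, Pi.pow_apply]
    field_simp
    ring
  have hlim := tendsto_firstIntegral_cornerPoint ν (σ := 1) (by simp)
  simp only [Complex.ofReal_one, one_mul] at hlim
  refine tendsto_nhds_unique (tendsto_const_nhds.congr' ?_) hlim
  filter_upwards [cornerPoint_mem_upperLens (σ := 1) (by simp)] with δ hδ
  exact eq_of_hasDerivAt_zero_upperLens hd hz hδ

/-- The same pairing with v², evaluated at z = -1; the cross term changes sign because the flux of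
P_ν(-z) is `-legendreMom ν (-z)`. -/
theorem firstIntegral_left (ν : ℂ) {z : ℂ} (hz : z ∈ legendreLens ∩ {z | 0 < z.im}) :
    legendreMom ν (-z) ^ 2 * cauchyTransform (legendreProd ν) z +
      legendreFun ν (-z) * legendreMom ν (-z) * legendreTransformMom ν z +
      legendreFun ν (-z) ^ 2 * legendreTransformMomProd ν z =
        2 * (Complex.sin (ν * Real.pi) / Real.pi) := by
  set f : ℂ → ℂ := fun z => legendreMom ν (-z) ^ 2 * cauchyTransform (legendreProd ν) z +
      legendreFun ν (-z) * legendreMom ν (-z) * legendreTransformMom ν z +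
      legendreFun ν (-z) ^ 2 * legendreTransformMomProd ν z with hf
  have hd : ∀ z ∈ legendreLens ∩ {z | 0 < z.im}, HasDerivAt f 0 z := by
    rintro z ⟨hL, hz⟩
    have hp := one_sub_sq_ne_zero_of_mem_legendreLens hL
    have hu := hasDerivAt_legendreFun_neg ν hL.2 hp
    have hU := hasDerivAt_legendreMom_neg ν hL.2
    convert! (((hU.pow 2).mul (hasDerivAt_cauchyTransform_legendreProd ν hz)).add
      ((hu.mul hU).mul (hasDerivAt_legendreTransformMom ν hz))).add
      ((hu.pow 2).mul (hasDerivAt_legendreTransformMomProd ν hz)) using 1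
    simp only [Pi.mul_apply, Pi.pow_apply]
    field_simp
    ring
  have hlim := tendsto_firstIntegral_cornerPoint ν (σ := -1) (by simp)
  simp only [Complex.ofReal_neg, Complex.ofReal_one, neg_mul, one_mul, sub_neg_eq_add,
    neg_neg] at hlim
  refine tendsto_nhds_unique (tendsto_const_nhds.congr' ?_) hlim
  filter_upwards [cornerPoint_mem_upperLens (σ := -1) (by simp)] with δ hδ
  exact eq_of_hasDerivAt_zero_upperLens hd hz hδ

/-- This is the polarization of the two preceding pairings. Its value is left unknown, since parity
removes it on the real axis. -/
theorem exists_firstIntegral_mixed (ν : ℂ) : ∃ b : ℂ, ∀ z ∈ legendreLens ∩ {z | 0 < z.im},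
    -(2 * legendreMom ν z * legendreMom ν (-z) * cauchyTransform (legendreProd ν) z) -
      (legendreFun ν (-z) * legendreMom ν z - legendreFun ν z * legendreMom ν (-z)) *
        legendreTransformMom ν z +
      2 * legendreFun ν z * legendreFun ν (-z) * legendreTransformMomProd ν z = b := by
  set f : ℂ → ℂ := fun z =>
    -(2 * legendreMom ν z * legendreMom ν (-z) * cauchyTransform (legendreProd ν) z) -
      (legendreFun ν (-z) * legendreMom ν z - legendreFun ν z * legendreMom ν (-z)) *
        legendreTransformMom ν z +
      2 * legendreFun ν z * legendreFun ν (-z) * legendreTransformMomProd ν z with hf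
  have hd : ∀ z ∈ legendreLens ∩ {z | 0 < z.im}, HasDerivAt f 0 z := by
    rintro z ⟨hL, hz⟩
    have hp := one_sub_sq_ne_zero_of_mem_legendreLens hL
    have hu := hasDerivAt_legendreFun ν hL.1 hp
    have hU := hasDerivAt_legendreMom ν hL.1
    have hv := hasDerivAt_legendreFun_neg ν hL.2 hp
    have hV := hasDerivAt_legendreMom_neg ν hL.2
    convert! ((((hU.const_mul 2).mul hV).mul (hasDerivAt_cauchyTransform_legendreProd ν hz)).neg.sub
      (((hv.mul hU).sub (hu.mul hV)).mul (hasDerivAt_legendreTransformMom ν hz))).add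
      (((hu.const_mul 2).mul hv).mul (hasDerivAt_legendreTransformMomProd ν hz)) using 1
    simp only [Pi.mul_apply, Pi.sub_apply]
    field_simp
    ring
  obtain ⟨δ, hδ⟩ := (cornerPoint_mem_upperLens (σ := 1) (by simp)).exists
  exact ⟨f (cornerPoint 1 δ), fun z hz => eq_of_hasDerivAt_zero_upperLens hd hz hδ⟩

/-- The Cauchy transform of `P_ν(x) P_ν(-x)` is a quadratic form in `P_ν(z)` and `P_ν(-z)` on the
upper half of the lens. -/
theorem exists_cauchyTransform_legendreProd_eq {ν : ℂ} (hν : Complex.sin (ν * Real.pi) ≠ 0) :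
    ∃ b : ℂ, ∀ z ∈ legendreLens, 0 < z.im → cauchyTransform (legendreProd ν) z =
      Real.pi / (2 * Complex.sin (ν * Real.pi)) * (legendreFun ν z ^ 2 - legendreFun ν (-z) ^ 2) +
        b * (legendreFun ν z * legendreFun ν (-z)) := by
  obtain ⟨b, hb⟩ := exists_firstIntegral_mixed ν
  set S := 2 * (Complex.sin (ν * Real.pi) / Real.pi) with hS
  have hpi : (Real.pi : ℂ) ≠ 0 := by exact_mod_cast Real.pi_ne_zero
  have hS0 : S ≠ 0 := mul_ne_zero two_ne_zero (div_ne_zero hν hpi)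
  refine ⟨-b / S ^ 2, fun z hL hz => ?_⟩
  have e1 := firstIntegral_right ν ⟨hL, hz⟩
  have e2 := firstIntegral_left ν ⟨hL, hz⟩
  have e3 := hb z ⟨hL, hz⟩
  have hW := legendre_wronskian ν hL
  rw [← hS] at e1 e2 hW
  have hS' : (Real.pi : ℂ) / (2 * Complex.sin (ν * Real.pi)) = 1 / S := by
    rw [hS]; field_simp
  rw [hS']
  set u := legendreFun ν z
  set v := legendreFun ν (-z)
  set U := legendreMom ν z
  set V := legendreMom ν (-z)
  set G := cauchyTransform (legendreProd ν) z
  have key : S ^ 2 * G = S * (u ^ 2 - v ^ 2) - b * (u * v) := by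
    -- The combination u²·(left) + v²·(right) - uv·(mixed) eliminates the second and third
    -- components and leaves G times the square of the Wronskian.
    have hsq : S ^ 2 = (-(u * V) - v * U) ^ 2 := by rw [hW]; ring
    rw [hsq]
    linear_combination u ^ 2 * e2 + v ^ 2 * e1 - u * v * e3
  field_simp
  linear_combination key

/-! ### Principal values and boundary values of the Cauchy transform -/

/-- The finite Hilbert transform of `w` at `x ∈ (-1, 1)`, in regularized form. -/
noncomputable def finiteHilbertTransform (w : ℝ → ℂ) (x : ℝ) : ℂ :=
  (∫ ξ in Ioo (-1 : ℝ) 1, (w ξ - w x) / ((x : ℂ) - ξ)) +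
    w x * (Real.log (1 + x) - Real.log (1 - x) : ℝ)

theorem HasPrincipalValue.const_mul {f : ℝ → ℂ} {a b c : ℝ} {I : ℂ}
    (h : HasPrincipalValue f a b c I) (k : ℂ) :
    HasPrincipalValue (fun ξ => k * f ξ) a b c (k * I) := by
  refine ⟨fun ε hε => (h.1 ε hε).const_mul k, ?_⟩
  simp_rw [integral_const_mul]
  exact h.2.const_mul k

theorem integrableOn_Ioo_diff_Icc_div {w : ℝ → ℂ} (hw : IntegrableOn w (Ioo (-1 : ℝ) 1)) (x : ℝ)
    {ε : ℝ} (hε : 0 < ε) :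
    IntegrableOn (fun ξ : ℝ => w ξ / ((x : ℂ) - ξ)) (Ioo (-1 : ℝ) 1 \ Icc (x - ε) (x + ε)) := by
  simp_rw [div_eq_mul_inv]
  refine Integrable.mul_bdd (c := ε⁻¹) (hw.mono_set sdiff_subset) ?_ ?_
  · have : Measurable fun ξ : ℝ => ((x : ℂ) - ξ)⁻¹ := by fun_prop
    exact this.aestronglyMeasurable
  · filter_upwards [ae_restrict_mem (measurableSet_Ioo.diff measurableSet_Icc)] with ξ hξ
    rw [norm_inv, ← Complex.ofReal_sub, Complex.norm_real, Real.norm_eq_abs]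
    have : ε ≤ |x - ξ| := by
      by_contra! hlt
      rw [abs_lt] at hlt
      exact hξ.2 ⟨by linarith, by linarith⟩
    gcongr

/-- The two log ε contributions cancel by symmetry of the excised interval, so the value does not
depend on ε. -/
theorem integral_Ioo_diff_Icc_inv {x ε : ℝ} (hε : 0 < ε) (h1 : ε < 1 + x) (h2 : ε < 1 - x) :
    ∫ ξ in Ioo (-1 : ℝ) 1 \ Icc (x - ε) (x + ε), (1 : ℂ) / ((x : ℂ) - ξ) =
      (Real.log (1 + x) - Real.log (1 - x) : ℝ) := by
  have hset : Ioo (-1 : ℝ) 1 \ Icc (x - ε) (x + ε) = Ioo (-1) (x - ε) ∪ Ioo (x + ε) 1 := by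
    ext ξ
    simp only [Set.mem_sdiff, mem_Ioo, mem_Icc, mem_union, not_and_or, not_le]
    constructor
    · rintro ⟨⟨h3, h4⟩, h5 | h5⟩
      · exact Or.inl ⟨h3, h5⟩
      · exact Or.inr ⟨h5, h4⟩
    · rintro (⟨h3, h4⟩ | ⟨h3, h4⟩)
      · exact ⟨⟨h3, by linarith⟩, Or.inl h4⟩
      · exact ⟨⟨by linarith, h4⟩, Or.inr h3⟩
  have hone : IntegrableOn (fun _ : ℝ => (1 : ℂ)) (Ioo (-1 : ℝ) 1) := integrableOn_const (by simp)
  have hint := integrableOn_Ioo_diff_Icc_div hone x hε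
  have hdisj : Disjoint (Ioo (-1) (x - ε)) (Ioo (x + ε) 1) := by
    rw [Set.disjoint_left]
    rintro ξ ⟨_, h3⟩ ⟨h4, _⟩
    linarith
  rw [hset] at hint ⊢
  rw [setIntegral_union hdisj measurableSet_Ioo (hint.mono_set subset_union_left)
    (hint.mono_set subset_union_right)]
  have hcast : ∀ ξ : ℝ, (1 : ℂ) / ((x : ℂ) - ξ) = (((x - ξ)⁻¹ : ℝ) : ℂ) := fun ξ => by
    push_cast; rw [one_div]
  simp_rw [hcast]
  rw [integral_complex_ofReal, integral_complex_ofReal, ← Complex.ofReal_add]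
  congr 1
  rw [← integral_Ioc_eq_integral_Ioo, ← integral_Ioc_eq_integral_Ioo,
    ← intervalIntegral.integral_of_le (by linarith), ← intervalIntegral.integral_of_le (by linarith),
    intervalIntegral.integral_comp_sub_left (fun t => t⁻¹),
    intervalIntegral.integral_comp_sub_left (fun t => t⁻¹),
    integral_inv_of_pos (by linarith) (by linarith), integral_inv_of_neg (by linarith) (by linarith),
    show x - (x - ε) = ε by ring, show (x - (x + ε)) / (x - 1) = ε / (1 - x) by
      rw [show x - (x + ε) = -ε by ring, show x - 1 = -(1 - x) by ring, neg_div_neg_eq],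
    Real.log_div (by linarith) (by linarith), Real.log_div (by linarith) (by linarith)]
  rw [show x - -1 = 1 + x by ring]
  ring

theorem hasPrincipalValue_finiteHilbertTransform {w : ℝ → ℂ} {x : ℝ} (hx : x ∈ Ioo (-1 : ℝ) 1)
    (hw : IntegrableOn w (Ioo (-1 : ℝ) 1))
    (hd : IntegrableOn (fun ξ : ℝ => (w ξ - w x) / ((x : ℂ) - ξ)) (Ioo (-1 : ℝ) 1)) :
    HasPrincipalValue (fun ξ => w ξ / ((x : ℂ) - ξ)) (-1) 1 x (finiteHilbertTransform w x) := by
  refine ⟨fun ε hε => integrableOn_Ioo_diff_Icc_div hw x hε, ?_⟩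
  have hone : IntegrableOn (fun _ : ℝ => (1 : ℂ)) (Ioo (-1 : ℝ) 1) := integrableOn_const (by simp)
  have hlim : Tendsto (fun ε : ℝ => ∫ ξ in Ioo (-1 : ℝ) 1 \ Icc (x - ε) (x + ε),
      (w ξ - w x) / ((x : ℂ) - ξ)) (𝓝[>] 0)
      (𝓝 (∫ ξ in Ioo (-1 : ℝ) 1, (w ξ - w x) / ((x : ℂ) - ξ))) := by
    have e : ∀ ε : ℝ, ∫ ξ in Ioo (-1 : ℝ) 1 \ Icc (x - ε) (x + ε),
        (w ξ - w x) / ((x : ℂ) - ξ) = ∫ ξ in Ioo (-1 : ℝ) 1,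
          ((Icc (x - ε) (x + ε))ᶜ).indicator (fun ξ : ℝ => (w ξ - w x) / ((x : ℂ) - ξ)) ξ :=
      fun ε => by
        rw [setIntegral_indicator measurableSet_Icc.compl, sdiff_eq]
    simp_rw [e]
    refine tendsto_integral_filter_of_dominated_convergence
      (fun ξ => ‖(w ξ - w x) / ((x : ℂ) - ξ)‖) ?_ ?_ hd.norm ?_
    · exact Eventually.of_forall fun ε => hd.aestronglyMeasurable.indicator measurableSet_Icc.compl
    · exact Eventually.of_forall fun ε => ae_of_all _ fun ξ => norm_indicator_le_norm_self _ _
    · refine ae_of_all _ fun ξ => ?_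
      refine tendsto_const_nhds.congr' ?_
      rcases eq_or_ne ξ x with rfl | hne
      · refine Eventually.of_forall fun ε => ?_
        -- At ξ = x the quotient 0/0 is 0 by convention, so the pointwise limit holds there too.
        rw [sub_self, zero_div, eq_comm, indicator_apply_eq_zero]
        simp
      · filter_upwards [Ioo_mem_nhdsGT (abs_pos.mpr (sub_ne_zero.mpr hne))] with ε hε
        rw [indicator_of_mem]
        rintro ⟨h1, h2⟩
        have : |ξ - x| ≤ ε := abs_le.mpr ⟨by linarith, by linarith⟩
        linarith [hε.2]
  refine (hlim.add_const (w x * (Real.log (1 + x) - Real.log (1 - x) : ℝ))).congr' ?_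
  filter_upwards [Ioo_mem_nhdsGT (show 0 < min (1 + x) (1 - x) from
    lt_min (by linarith [hx.1]) (by linarith [hx.2]))] with ε hε
  have h1 := hε.2.trans_le (min_le_left _ _)
  have h2 := hε.2.trans_le (min_le_right _ _)
  rw [← integral_Ioo_diff_Icc_inv hε.1 h1 h2, ← integral_const_mul, ← integral_add
    (hd.mono_set sdiff_subset) ((integrableOn_Ioo_diff_Icc_div hone x hε.1).const_mul (w x))]
  congr 1 with ξ
  ring

theorem cauchyTransform_one {z : ℂ} (hz : 0 < z.im) :
    ∫ ξ in Ioo (-1 : ℝ) 1, (1 : ℂ) / (z - ξ) = Complex.log (z + 1) - Complex.log (z - 1) := by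
  have hone : IntegrableOn (fun _ : ℝ => (1 : ℂ)) (Ioo (-1 : ℝ) 1) := integrableOn_const (by simp)
  have hder : ∀ x : ℝ, HasDerivAt (fun ξ : ℝ => -Complex.log (z - ξ)) (1 / (z - x)) x := by
    intro x
    -- The segment z - ξ stays in the upper half plane, so the principal logarithm is a primitive
    -- along all of it.
    have hsl : z - x ∈ Complex.slitPlane := Or.inr (by simpa using hz.ne')
    have hd : HasDerivAt (fun ξ : ℂ => z - ξ) (-1) (x : ℂ) := (hasDerivAt_id (x : ℂ)).const_sub z
    have h := (hd.clog hsl).neg.comp_ofReal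
    convert! h using 1
    ring
  have hc : Continuous fun ξ : ℝ => -Complex.log (z - ξ) :=
    continuous_iff_continuousAt.mpr fun x => (hder x).continuousAt
  rw [integral_Ioo_eq_sub_of_hasDerivAt (fun x _ => hder x) (integrableOn_div_sub_ofReal hone hz)
    ((hc.tendsto (-1)).mono_left nhdsWithin_le_nhds) ((hc.tendsto 1).mono_left nhdsWithin_le_nhds)]
  simp
  ring

/-- The boundary value of the Cauchy transform from the upper half plane. -/
theorem tendsto_cauchyTransform_ofReal_add {w : ℝ → ℂ} {x : ℝ} (hx : x ∈ Ioo (-1 : ℝ) 1)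
    (hw : IntegrableOn w (Ioo (-1 : ℝ) 1))
    (hd : IntegrableOn (fun ξ : ℝ => (w ξ - w x) / ((x : ℂ) - ξ)) (Ioo (-1 : ℝ) 1)) :
    Tendsto (fun y : ℝ => cauchyTransform w (x + y * Complex.I)) (𝓝[>] 0)
      (𝓝 (finiteHilbertTransform w x - Real.pi * Complex.I * w x)) := by
  have hone : IntegrableOn (fun _ : ℝ => (1 : ℂ)) (Ioo (-1 : ℝ) 1) := integrableOn_const (by simp)
  have hdiff : IntegrableOn (fun ξ => w ξ - w x) (Ioo (-1 : ℝ) 1) :=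
    hw.sub (integrableOn_const (by simp))
  have hz : Tendsto (fun y : ℝ => (x : ℂ) + y * Complex.I) (𝓝[>] 0) (𝓝 x) := by
    have hc : Continuous fun y : ℝ => (x : ℂ) + y * Complex.I := by fun_prop
    simpa using (hc.tendsto 0).mono_left nhdsWithin_le_nhds
  have him : ∀ y : ℝ, ((x : ℂ) + y * Complex.I).im = y := fun y => by simp
  have hlim1 : Tendsto (fun y : ℝ => ∫ ξ in Ioo (-1 : ℝ) 1, (w ξ - w x) / (x + y * Complex.I - ξ))
      (𝓝[>] 0) (𝓝 (∫ ξ in Ioo (-1 : ℝ) 1, (w ξ - w x) / ((x : ℂ) - ξ))) := by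
    refine tendsto_integral_filter_of_dominated_convergence
      (fun ξ => ‖(w ξ - w x) / ((x : ℂ) - ξ)‖) ?_ ?_ hd.norm ?_
    · filter_upwards [self_mem_nhdsWithin] with y (hy : 0 < y)
      exact (integrableOn_div_sub_ofReal hdiff (by rwa [him])).aestronglyMeasurable
    · refine Eventually.of_forall fun y => ae_of_all _ fun ξ => ?_
      rcases eq_or_ne ξ x with rfl | hne
      · simp
      · rw [norm_div, norm_div]
        have h1 : ‖(x : ℂ) - ξ‖ ≤ ‖(x : ℂ) + y * Complex.I - ξ‖ := by
          have := Complex.abs_re_le_norm ((x : ℂ) + y * Complex.I - ξ)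
          rw [← Complex.ofReal_sub, Complex.norm_real]
          simpa using this
        have h2 : 0 < ‖(x : ℂ) - ξ‖ := by
          rw [norm_pos_iff, sub_ne_zero]
          exact_mod_cast hne.symm
        gcongr
    · refine ae_of_all _ fun ξ => ?_
      rcases eq_or_ne ξ x with rfl | hne
      · simp
      · refine Tendsto.div tendsto_const_nhds (hz.sub_const _) (sub_ne_zero.mpr ?_)
        exact_mod_cast hne.symm
  have hlog1 : Tendsto (fun y : ℝ => Complex.log (x + y * Complex.I + 1)) (𝓝[>] 0)
      (𝓝 (Real.log (1 + x) : ℝ)) := by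
    rw [Complex.ofReal_log (by linarith [hx.1])]
    have hsl : ((1 + x : ℝ) : ℂ) ∈ Complex.slitPlane := by
      rw [Complex.ofReal_mem_slitPlane]; linarith [hx.1]
    refine (continuousAt_clog hsl).tendsto.comp ?_
    have := hz.add_const 1
    rw [add_comm (x : ℂ)] at this
    push_cast
    exact this
  -- Here z - 1 approaches the negative axis from above. The argument π picked up is the source of
  -- the term -πi·w(x).
  have hlog2 : Tendsto (fun y : ℝ => Complex.log (x + y * Complex.I - 1)) (𝓝[>] 0)
      (𝓝 ((Real.log (1 - x) : ℝ) + Real.pi * Complex.I)) := by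
    have h := Complex.tendsto_log_nhdsWithin_im_nonneg_of_re_neg_of_im_zero (z := (x : ℂ) - 1)
      (by simpa using hx.2) (by simp)
    have hnorm : ‖(x : ℂ) - 1‖ = 1 - x := by
      rw [← Complex.ofReal_one, ← Complex.ofReal_sub, Complex.norm_real, Real.norm_eq_abs,
        abs_of_neg (by linarith [hx.2])]
      ring
    rw [hnorm] at h
    refine h.comp (tendsto_nhdsWithin_iff.mpr ⟨hz.sub_const 1, ?_⟩)
    filter_upwards [self_mem_nhdsWithin] with y (hy : 0 < y)
    simpa using hy.le
  have hlim := hlim1.add ((hlog1.sub hlog2).const_mul (w x))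
  have hval : finiteHilbertTransform w x - Real.pi * Complex.I * w x =
      (∫ ξ in Ioo (-1 : ℝ) 1, (w ξ - w x) / ((x : ℂ) - ξ)) + w x * ((Real.log (1 + x) : ℝ) -
        ((Real.log (1 - x) : ℝ) + Real.pi * Complex.I)) := by
    rw [finiteHilbertTransform]
    push_cast
    ring
  rw [hval]
  refine hlim.congr' ?_
  filter_upwards [self_mem_nhdsWithin] with y (hy : 0 < y)
  have hy' : 0 < ((x : ℂ) + y * Complex.I).im := by rwa [him]
  rw [← cauchyTransform_one hy', ← integral_const_mul, cauchyTransform, ← integral_add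
    (integrableOn_div_sub_ofReal hdiff hy') ((integrableOn_div_sub_ofReal hone hy').const_mul _)]
  congr 1 with ξ
  ring

theorem finiteHilbertTransform_neg {w : ℝ → ℂ} (heven : ∀ x, w (-x) = w x) (x : ℝ) :
    finiteHilbertTransform w (-x) = -finiteHilbertTransform w x := by
  have h : ∫ ξ in Ioo (-1 : ℝ) 1, (w ξ - w (-x)) / (((-x : ℝ) : ℂ) - ξ) =
      -∫ ξ in Ioo (-1 : ℝ) 1, (w ξ - w x) / ((x : ℂ) - ξ) := by
    rw [← integral_neg, ← integral_Ioc_eq_integral_Ioo,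
      ← intervalIntegral.integral_of_le (by norm_num), ← integral_Ioc_eq_integral_Ioo,
      ← intervalIntegral.integral_of_le (by norm_num)]
    have := intervalIntegral.integral_comp_neg (a := -1) (b := 1)
      (fun ξ : ℝ => (w ξ - w (-x)) / (((-x : ℝ) : ℂ) - ξ))
    rw [neg_neg] at this
    rw [← this]
    congr 1 with ξ
    rw [heven, heven, ← div_neg]
    push_cast
    ring
  rw [finiteHilbertTransform, finiteHilbertTransform, h, heven]
  push_cast
  rw [← sub_eq_add_neg, sub_neg_eq_add]
  ring

/-! ### The Hilbert transform of the product for non-integer degree -/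

/-- For ξ near x the mean value inequality is used, the ball of radius r = (1-|x|)/2 satisfying 1 -
y² ≥ r; elsewhere |x-ξ| ≥ r suffices. The bound depends on ν only through K, so it also dominates
when ν varies. -/
theorem norm_legendreProd_slope_le {ν : ℂ} {K : ℝ} (hK : ∀ n : ℕ, ‖(n : ℂ) * legendreCoeff ν n‖ ≤ K)
    {x ξ : ℝ} (hx : x ∈ Ioo (-1 : ℝ) 1) (hξ : ξ ∈ Ioo (-1 : ℝ) 1) :
    ‖(legendreProd ν ξ - legendreProd ν x) / ((x : ℂ) - ξ)‖ ≤
      (4 * K * (1 + 4 * K) + (1 + 4 * K) ^ 2 * (endpointBound ξ + endpointBound x)) /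
        ((1 - |x|) / 2) := by
  have hK0 : 0 ≤ K := (norm_nonneg _).trans (hK 0)
  have hxa : |x| < 1 := abs_lt.mpr hx
  set r := (1 - |x|) / 2 with hr
  have hr0 : 0 < r := by rw [hr]; linarith
  have hg : ∀ y ∈ Ioo (-1 : ℝ) 1, 0 ≤ endpointBound y := fun y hy =>
    add_nonneg (Real.rpow_nonneg (by linarith [hy.1]) _) (Real.rpow_nonneg (by linarith [hy.2]) _)
  have hA : 0 ≤ (1 + 4 * K) ^ 2 * (endpointBound ξ + endpointBound x) :=
    mul_nonneg (sq_nonneg _) (add_nonneg (hg ξ hξ) (hg x hx))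
  have hM : 0 ≤ 4 * K * (1 + 4 * K) := by positivity
  rw [norm_div, ← Complex.ofReal_sub, Complex.norm_real, Real.norm_eq_abs]
  rcases lt_or_ge |x - ξ| r with hlt | hge
  · rcases eq_or_ne x ξ with rfl | hne
    · simp only [sub_self, norm_zero, zero_div]
      positivity
    have hpos : 0 < |x - ξ| := abs_pos.mpr (sub_ne_zero.mpr hne)
    have hball : ∀ y ∈ Metric.ball x r, y ∈ Ioo (-1 : ℝ) 1 ∧ r ≤ 1 - y ^ 2 := by
      intro y hy
      rw [Metric.mem_ball, Real.dist_eq] at hy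
      have h1 : |y| ≤ 1 - r := by
        have := abs_add_le (y - x) x
        rw [sub_add_cancel] at this
        linarith
      have h2 := abs_le.mp h1
      refine ⟨⟨by linarith, by linarith⟩, ?_⟩
      rw [← sq_abs]
      nlinarith [abs_nonneg y]
    have hmv := (convex_ball x r).norm_image_sub_le_of_norm_hasDerivWithin_le
      (f := legendreProd ν) (f' := fun y => legendreProdMom ν y / (1 - (y : ℂ) ^ 2))
      (C := 4 * K * (1 + 4 * K) / r)
      (fun y hy => (hasDerivAt_legendreProd ν (hball y hy).1).hasDerivWithinAt) ?_
      (Metric.mem_ball_self hr0) (y := ξ) (by rwa [Metric.mem_ball, Real.dist_eq, abs_sub_comm])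
    · rw [div_le_iff₀ hpos]
      refine hmv.trans ?_
      rw [Real.norm_eq_abs, abs_sub_comm ξ x]
      gcongr
      linarith
    · intro y hy
      obtain ⟨hy1, hy2⟩ := hball y hy
      have e : ‖1 - (y : ℂ) ^ 2‖ = 1 - y ^ 2 := by
        rw [← Complex.ofReal_one, ← Complex.ofReal_pow, ← Complex.ofReal_sub, Complex.norm_real,
          Real.norm_of_nonneg (by linarith)]
      rw [norm_div, e]
      exact div_le_div₀ hM (norm_legendreProdMom_le hK hy1) hr0 hy2
  · refine div_le_div₀ (by positivity) ?_ hr0 hge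
    refine (norm_sub_le _ _).trans ?_
    linarith [norm_legendreProd_le hK hξ, norm_legendreProd_le hK hx]

theorem integrableOn_legendreProd_slope_bound (K x : ℝ) :
    IntegrableOn (fun ξ => (4 * K * (1 + 4 * K) + (1 + 4 * K) ^ 2 *
      (endpointBound ξ + endpointBound x)) / ((1 - |x|) / 2)) (Ioo (-1 : ℝ) 1) := by
  refine Integrable.div_const (Integrable.add (integrableOn_const (by simp)) ?_) _
  exact (integrableOn_endpointBound.add (integrableOn_const (by simp))).const_mul _

theorem aestronglyMeasurable_legendreProd_slope (ν : ℂ) (x : ℝ) :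
    AEStronglyMeasurable (fun ξ : ℝ => (legendreProd ν ξ - legendreProd ν x) / ((x : ℂ) - ξ))
      (volume.restrict (Ioo (-1 : ℝ) 1)) := by
  have h : Measurable fun ξ : ℝ => ((x : ℂ) - ξ)⁻¹ := by fun_prop
  simp_rw [div_eq_mul_inv]
  exact ((integrableOn_legendreProd ν).aestronglyMeasurable.sub
    aestronglyMeasurable_const).mul h.aestronglyMeasurable

theorem integrableOn_legendreProd_slope (ν : ℂ) {x : ℝ} (hx : x ∈ Ioo (-1 : ℝ) 1) :
    IntegrableOn (fun ξ : ℝ => (legendreProd ν ξ - legendreProd ν x) / ((x : ℂ) - ξ))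
      (Ioo (-1 : ℝ) 1) := by
  obtain ⟨K, hK0, hK⟩ := exists_norm_mul_legendreCoeff_le ‖ν‖
  refine Integrable.mono' (integrableOn_legendreProd_slope_bound K x)
    (aestronglyMeasurable_legendreProd_slope ν x) ?_
  filter_upwards [ae_restrict_mem measurableSet_Ioo] with ξ hξ
  exact norm_legendreProd_slope_le (hK ν le_rfl) hx hξ

/-- The finite Hilbert transform of `P_ν(x) P_ν(-x)` for non-integer `ν`. -/
theorem finiteHilbertTransform_legendreProd {ν : ℂ} (hν : Complex.sin (ν * Real.pi) ≠ 0) {x : ℝ}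
    (hx : x ∈ Ioo (-1 : ℝ) 1) :
    finiteHilbertTransform (legendreProd ν) x = Real.pi / (2 * Complex.sin (ν * Real.pi)) *
      (legendreFun ν x ^ 2 - legendreFun ν (-x) ^ 2) := by
  obtain ⟨b, hb⟩ := exists_cauchyTransform_legendreProd_eq hν
  have key : ∀ x ∈ Ioo (-1 : ℝ) 1, finiteHilbertTransform (legendreProd ν) x -
      Real.pi * Complex.I * legendreProd ν x = Real.pi / (2 * Complex.sin (ν * Real.pi)) *
      (legendreFun ν x ^ 2 - legendreFun ν (-x) ^ 2) + b * legendreProd ν x := by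
    intro x hx
    have hL := ofReal_mem_legendreLens hx
    have hz : Tendsto (fun y : ℝ => (x : ℂ) + y * Complex.I) (𝓝[>] 0) (𝓝 x) := by
      have hc : Continuous fun y : ℝ => (x : ℂ) + y * Complex.I := by fun_prop
      simpa using (hc.tendsto 0).mono_left nhdsWithin_le_nhds
    have hu := (continuousAt_legendreFun ν hL.1).tendsto.comp hz
    have hv := (continuousAt_legendreFun ν (z := -x) (by simpa using hL.2)).tendsto.comp hz.neg
    have hlim := (((hu.pow 2).sub (hv.pow 2)).const_mul
      (Real.pi / (2 * Complex.sin (ν * Real.pi)))).add ((hu.mul hv).const_mul b)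
    refine tendsto_nhds_unique (tendsto_cauchyTransform_ofReal_add hx (integrableOn_legendreProd ν)
      (integrableOn_legendreProd_slope ν hx)) (hlim.congr' ?_)
    filter_upwards [self_mem_nhdsWithin, hz (isOpen_legendreLens.mem_nhds hL)] with y hy hyL
    exact (hb _ hyL (by simpa using hy)).symm
  have h1 := key x hx
  have h2 := key (-x) (neg_mem_Ioo_one hx)
  rw [finiteHilbertTransform_neg (legendreProd_neg ν), legendreProd_neg] at h2
  push_cast at h2
  rw [neg_neg] at h2
  -- Half the difference of the identities at x and -x is their odd part; both b·w and πi·w are even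
  -- and cancel.
  linear_combination (1 / 2) * h1 - (1 / 2) * h2

theorem sin_mul_pi_ne_zero {ν : ℂ} (hν : ∀ k : ℤ, ν ≠ (k : ℂ)) :
    Complex.sin (ν * Real.pi) ≠ 0 := by
  rw [Ne, Complex.sin_eq_zero_iff]
  rintro ⟨k, hk⟩
  have hpi : (Real.pi : ℂ) ≠ 0 := by exact_mod_cast Real.pi_ne_zero
  exact hν k (mul_right_cancel₀ hpi hk)

theorem legendreP_mul_legendreP_neg (ν : ℂ) (x : ℝ) :
    legendreP ν x * legendreP ν (-x) = legendreProd ν x := by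
  rw [legendreP_eq_legendreFun, legendreP_eq_legendreFun, legendreProd]
  push_cast
  rfl

theorem hasPrincipalValue_legendreP_mul_legendreP_neg {ν : ℂ} (hν : ∀ k : ℤ, ν ≠ (k : ℂ)) {x : ℝ}
    (hx : x ∈ Ioo (-1 : ℝ) 1) :
    HasPrincipalValue
      (fun ξ : ℝ => 2 * legendreP ν ξ * legendreP ν (-ξ) / ((Real.pi : ℂ) * ((x : ℂ) - (ξ : ℂ))))
      (-1) 1 x ((legendreP ν x ^ 2 - legendreP ν (-x) ^ 2) / Complex.sin (ν * Real.pi)) := by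
  have hs := sin_mul_pi_ne_zero hν
  have hpi : (Real.pi : ℂ) ≠ 0 := by exact_mod_cast Real.pi_ne_zero
  have h := (hasPrincipalValue_finiteHilbertTransform hx (integrableOn_legendreProd ν)
    (integrableOn_legendreProd_slope ν hx)).const_mul (2 / Real.pi)
  rw [finiteHilbertTransform_legendreProd hs hx] at h
  convert! h using 1
  · ext ξ
    rw [mul_assoc, legendreP_mul_legendreP_neg, mul_div_mul_comm]
  · rw [legendreP_eq_legendreFun, legendreP_eq_legendreFun]
    push_cast
    field_simp

/-! ### Integer degree -/

/-- The substitution ν ↦ -ν-1 exchanges the factors j - ν and j + ν + 1. -/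
theorem legendreCoeff_neg_sub_one (ν : ℂ) (n : ℕ) :
    legendreCoeff (-ν - 1) n = legendreCoeff ν n := by
  unfold legendreCoeff
  congr 1
  exact Finset.prod_congr rfl fun j _ => by ring

theorem legendreP_neg_sub_one (ν : ℂ) (x : ℝ) : legendreP (-ν - 1) x = legendreP ν x := by
  rw [legendreP_eq_legendreSeries, legendreP_eq_legendreSeries, legendreSeries, legendreSeries]
  simp_rw [legendreCoeff_neg_sub_one]

theorem legendreCoeff_natCast (n k : ℕ) :
    legendreCoeff n k = (-1) ^ k * n.choose k * (n + k).choose n := by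
  induction k with
  | zero => simp
  | succ k ih =>
    have h := legendreCoeff_succ n k
    rw [ih] at h
    have hk : ((k : ℂ) + 1) ≠ 0 := Nat.cast_add_one_ne_zero k
    have h1 : ((n.choose (k + 1) : ℕ) : ℂ) * (k + 1) = n.choose k * (n - k) := by
      rcases le_or_gt k n with hkn | hkn
      · have := Nat.choose_succ_right_eq n k
        rw [← Nat.cast_sub hkn]
        exact_mod_cast this
      · rw [Nat.choose_eq_zero_of_lt hkn, Nat.choose_eq_zero_of_lt (by omega)]
        simp
    have h2 : (((n + (k + 1)).choose n : ℕ) : ℂ) * (k + 1) = (n + k).choose n * (n + k + 1) := by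
      have := Nat.choose_mul_succ_eq (n + k) n
      rw [show n + k + 1 - n = k + 1 by omega] at this
      exact_mod_cast this.symm
    have hk2 : ((k : ℂ) + 1) ^ 2 ≠ 0 := pow_ne_zero 2 hk
    rw [← mul_right_inj' hk2, h, pow_succ]
    linear_combination (-1) ^ k * (n.choose (k + 1) : ℂ) * (k + 1) * h2 +
      (-1) ^ k * ((n + k).choose n : ℂ) * (n + k + 1) * h1

theorem legendreSeries_natCast (n : ℕ) (s : ℂ) :
    legendreSeries n s = Polynomial.aeval s (Polynomial.shiftedLegendre n) := by
  rw [legendreSeries, Polynomial.aeval_eq_sum_range, Polynomial.natDegree_shiftedLegendre]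
  rw [tsum_eq_sum (s := Finset.range (n + 1))]
  · refine Finset.sum_congr rfl fun k _ => ?_
    rw [legendreCoeff_natCast, Polynomial.coeff_shiftedLegendre, zsmul_eq_mul]
    push_cast
    ring
  · intro k hk
    rw [Finset.mem_range, not_lt] at hk
    rw [legendreCoeff_natCast, Nat.choose_eq_zero_of_lt (by omega)]
    simp

/-- The series terminates in the shifted Legendre polynomial, whose reflection s ↦ 1 - s is z ↦ -z.
-/
theorem legendreFun_natCast_neg (n : ℕ) (z : ℂ) :
    legendreFun n (-z) = (-1) ^ n * legendreFun n z := by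
  rw [legendreFun, legendreFun, legendreSeries_natCast, legendreSeries_natCast,
    Polynomial.shiftedLegendre_eval_symm]
  congr 3
  ring

theorem legendreProd_natCast (n : ℕ) (x : ℝ) :
    legendreProd n x = (-1) ^ n * legendreP n x ^ 2 := by
  rw [legendreProd, legendreFun_natCast_neg, legendreP_eq_legendreFun]
  ring

theorem differentiable_legendreCoeff (n : ℕ) : Differentiable ℂ fun ν => legendreCoeff ν n := by
  unfold legendreCoeff
  fun_prop

theorem differentiable_legendreFun {z : ℂ} (hz : ‖1 - z‖ < 2) :
    Differentiable ℂ fun ν => legendreFun ν z := by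
  intro ν
  obtain ⟨K, hK0, hK⟩ := exists_norm_mul_legendreCoeff_le (‖ν‖ + 1)
  have hs := norm_one_sub_div_two_lt hz
  have h : DifferentiableOn ℂ (fun ν => ∑' n, legendreCoeff ν n * ((1 - z) / 2) ^ n)
      (Metric.ball 0 (‖ν‖ + 1)) := by
    refine Complex.differentiableOn_tsum_of_summable_norm (u := fun n => (K + 1) * ‖(1 - z) / 2‖ ^ n)
      ((summable_geometric_of_lt_one (norm_nonneg _) hs).mul_left _)
      (fun n => ((differentiable_legendreCoeff n).mul_const _).differentiableOn)
      Metric.isOpen_ball fun n w hw => ?_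
    rw [norm_mul, norm_pow]
    gcongr
    rcases n with _ | n
    · simpa using hK0
    · have hw' : ‖w‖ ≤ ‖ν‖ + 1 := by simpa using (Metric.mem_ball.mp hw).le
      have := hK w hw' (n + 1)
      rw [norm_mul, Complex.norm_natCast] at this
      push_cast at this
      nlinarith [norm_nonneg (legendreCoeff w (n + 1)), n.cast_nonneg (α := ℝ)]
  exact h.differentiableAt (Metric.isOpen_ball.mem_nhds (by simp))

theorem hasDerivAt_sin_mul_pi (ν : ℂ) :
    HasDerivAt (fun ν : ℂ => Complex.sin (ν * Real.pi)) (Complex.cos (ν * Real.pi) * Real.pi) ν := by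
  simpa using ((hasDerivAt_id ν).mul_const (Real.pi : ℂ)).csin

theorem cos_natCast_mul_pi (n : ℕ) : Complex.cos ((n : ℂ) * Real.pi) = (-1) ^ n := by
  have := Real.cos_nat_mul_pi n
  exact_mod_cast congrArg (fun r : ℝ => (r : ℂ)) this

theorem sin_natCast_mul_pi (n : ℕ) : Complex.sin ((n : ℂ) * Real.pi) = 0 := by
  have := Real.sin_nat_mul_pi n
  exact_mod_cast congrArg (fun r : ℝ => (r : ℂ)) this

theorem legendreQ_eq (ν : ℂ) (x : ℝ) : legendreQ ν x = Real.pi / (2 * Complex.sin (ν * Real.pi)) *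
    (Complex.cos (ν * Real.pi) * legendreFun ν x - legendreFun ν (-x)) := by
  rw [legendreQ, legendreP_eq_legendreFun, legendreP_eq_legendreFun]
  push_cast
  rfl

/-- Numerator and sine both vanish at ν = n, the former by parity of P_n, and the sine has a simple
zero. The quotient of difference quotients therefore converges, and `limUnder` is a genuine limit.
-/
theorem tendsto_legendreQ_legendreQNat (n : ℕ) {x : ℝ} (hx : x ∈ Ioo (-1 : ℝ) 1) :
    Tendsto (fun ν : ℂ => legendreQ ν x) (𝓝[≠] (n : ℂ)) (𝓝 (legendreQNat n x)) := by
  have hL := ofReal_mem_legendreLens hx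
  have hpi : (Real.pi : ℂ) ≠ 0 := by exact_mod_cast Real.pi_ne_zero
  set g : ℂ → ℂ := fun ν => Complex.cos (ν * Real.pi) * legendreFun ν x - legendreFun ν (-x) with hg
  have hgd : DifferentiableAt ℂ g n := by
    have h1 : Differentiable ℂ fun ν : ℂ => Complex.cos (ν * Real.pi) := by fun_prop
    exact ((h1.mul (differentiable_legendreFun hL.1)).sub
      (differentiable_legendreFun (by simpa using hL.2))) _
  have hg0 : g n = 0 := by
    simp only [hg]
    rw [cos_natCast_mul_pi, legendreFun_natCast_neg, sub_self]
  have hne : Complex.cos ((n : ℂ) * Real.pi) * Real.pi ≠ 0 := by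
    rw [cos_natCast_mul_pi]
    exact mul_ne_zero (pow_ne_zero _ (by norm_num)) hpi
  have hlim := ((hgd.hasDerivAt.tendsto_slope).div
    (hasDerivAt_sin_mul_pi n).tendsto_slope hne).const_mul ((Real.pi : ℂ) / 2)
  refine tendsto_nhds_limUnder ⟨_, hlim.congr' ?_⟩
  filter_upwards [self_mem_nhdsWithin] with ν (hν : ν ≠ n)
  have h0 : ν - n ≠ 0 := sub_ne_zero.mpr hν
  rw [legendreQ_eq, Pi.div_apply, slope_def_field, slope_def_field, hg0, sin_natCast_mul_pi,
    sub_zero, sub_zero, div_div_div_cancel_right₀ h0, div_mul_div_comm,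
    mul_comm_div, mul_div_assoc']

theorem continuous_legendreProd_degree {x : ℝ} (hx : x ∈ Ioo (-1 : ℝ) 1) :
    Continuous fun ν => legendreProd ν x := by
  have hL := ofReal_mem_legendreLens hx
  exact (differentiable_legendreFun hL.1).continuous.mul
    (differentiable_legendreFun (z := -x) (by simpa using hL.2)).continuous

theorem continuous_finiteHilbertTransform_legendreProd {x : ℝ} (hx : x ∈ Ioo (-1 : ℝ) 1) :
    Continuous fun ν => finiteHilbertTransform (legendreProd ν) x := by
  refine continuous_iff_continuousAt.mpr fun ν₀ => ?_
  obtain ⟨K, hK0, hK⟩ := exists_norm_mul_legendreCoeff_le (‖ν₀‖ + 1)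
  refine ContinuousAt.add ?_
    ((continuous_legendreProd_degree hx).continuousAt.mul continuousAt_const)
  refine tendsto_integral_filter_of_dominated_convergence _
    (Eventually.of_forall fun ν => aestronglyMeasurable_legendreProd_slope ν x) ?_
    (integrableOn_legendreProd_slope_bound K x) ?_
  · have hball : Metric.ball (0 : ℂ) (‖ν₀‖ + 1) ∈ 𝓝 ν₀ := Metric.isOpen_ball.mem_nhds (by simp)
    filter_upwards [hball] with ν hν
    have hν' : ‖ν‖ ≤ ‖ν₀‖ + 1 := by simpa using (Metric.mem_ball.mp hν).le
    filter_upwards [ae_restrict_mem measurableSet_Ioo] with ξ hξ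
    exact norm_legendreProd_slope_le (hK ν hν') hx hξ
  · filter_upwards [ae_restrict_mem measurableSet_Ioo] with ξ hξ
    exact (((continuous_legendreProd_degree hξ).sub (continuous_legendreProd_degree hx)).div_const
      _).continuousAt

theorem finiteHilbertTransform_legendreProd_natCast (n : ℕ) {x : ℝ} (hx : x ∈ Ioo (-1 : ℝ) 1) :
    finiteHilbertTransform (legendreProd n) x =
      2 * (-1) ^ n * (legendreP n x * legendreQNat n x) := by
  have hL := ofReal_mem_legendreLens hx
  have hpi : (Real.pi : ℂ) ≠ 0 := by exact_mod_cast Real.pi_ne_zero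
  have hu := (differentiable_legendreFun hL.1).continuous
  have hv := (differentiable_legendreFun (z := -x) (by simpa using hL.2)).continuous
  have hcos : Continuous fun ν : ℂ => Complex.cos (ν * Real.pi) := by fun_prop
  have hsin : Continuous fun ν : ℂ => Complex.sin (ν * Real.pi) := by fun_prop
  have hA := (((hcos.mul hu).add hv).tendsto n).mono_left (nhdsWithin_le_nhds (s := {(n : ℂ)}ᶜ))
  have hB := ((hsin.mul (hu.pow 2)).tendsto n).mono_left (nhdsWithin_le_nhds (s := {(n : ℂ)}ᶜ))
  -- The rewriting is π/(2 sin νπ)·(u² - v²) = Q_ν·(cos(νπ)u + v) + (π/2) sin(νπ)u², which follows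
  -- from cos² = 1 - sin². Every term on the right has a limit as ν → n.
  have hlim := ((tendsto_legendreQ_legendreQNat n hx).mul hA).add (hB.const_mul ((Real.pi : ℂ) / 2))
  simp only [Pi.add_apply, Pi.mul_apply, Pi.pow_apply] at hlim
  have hT := ((continuous_finiteHilbertTransform_legendreProd hx).tendsto n).mono_left
    (nhdsWithin_le_nhds (s := {(n : ℂ)}ᶜ))
  have hne : Complex.cos ((n : ℂ) * Real.pi) * Real.pi ≠ 0 := by
    rw [cos_natCast_mul_pi]
    exact mul_ne_zero (pow_ne_zero _ (by norm_num)) hpi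
  rw [tendsto_nhds_unique hT (hlim.congr' ?_)]
  · rw [sin_natCast_mul_pi, cos_natCast_mul_pi, legendreFun_natCast_neg, legendreP_eq_legendreFun]
    ring
  · filter_upwards [(hasDerivAt_sin_mul_pi n).eventually_ne (c := 0) hne] with ν hν
    rw [finiteHilbertTransform_legendreProd hν hx, legendreQ_eq]
    have hsq : Complex.cos (ν * Real.pi) ^ 2 = 1 - Complex.sin (ν * Real.pi) ^ 2 := by
      rw [← Complex.sin_sq_add_cos_sq (ν * Real.pi)]; ring
    generalize Complex.cos (ν * Real.pi) = c at hsq ⊢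
    generalize Complex.sin (ν * Real.pi) = s at hν hsq ⊢
    field_simp
    linear_combination legendreFun ν x ^ 2 * hsq

theorem hasPrincipalValue_legendreP_sq (n : ℕ) {x : ℝ} (hx : x ∈ Ioo (-1 : ℝ) 1) :
    HasPrincipalValue
      (fun ξ : ℝ => legendreP (n : ℂ) ξ ^ 2 / (2 * ((x : ℂ) - (ξ : ℂ))))
      (-1) 1 x (legendreP (n : ℂ) x * legendreQNat n x) := by
  have h := (hasPrincipalValue_finiteHilbertTransform hx (integrableOn_legendreProd n)
    (integrableOn_legendreProd_slope n hx)).const_mul ((-1) ^ n / 2)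
  have hsq : ((-1 : ℂ) ^ n) * (-1) ^ n = 1 := by rw [← mul_pow]; simp
  rw [finiteHilbertTransform_legendreProd_natCast n hx] at h
  convert! h using 1
  · ext ξ
    rw [legendreProd_natCast, div_mul_div_comm, ← mul_assoc, hsq, one_mul]
  · linear_combination -(legendreP n x * legendreQNat n x) * hsq

theorem mainTheorem3 :
    (∀ ν : ℂ, (∀ k : ℤ, ν ≠ (k : ℂ)) → ∀ x : ℝ, -1 < x → x < 1 →
      HasPrincipalValue
        (fun ξ : ℝ => 2 * legendreP ν ξ * legendreP ν (-ξ) / ((Real.pi : ℂ) * ((x : ℂ) - (ξ : ℂ))))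
        (-1) 1 x
        ((legendreP ν x ^ 2 - legendreP ν (-x) ^ 2) / Complex.sin (ν * Real.pi))) ∧
    (∀ n : ℕ, ∀ x : ℝ, -1 < x → x < 1 →
      Filter.Tendsto (fun ν : ℂ => legendreQ ν x) (nhdsWithin (n : ℂ) {(n : ℂ)}ᶜ)
        (nhds (legendreQNat n x)) ∧
      HasPrincipalValue
        (fun ξ : ℝ => legendreP (n : ℂ) ξ ^ 2 / (2 * ((x : ℂ) - (ξ : ℂ))))
        (-1) 1 x (legendreP (n : ℂ) x * legendreQNat n x) ∧
      HasPrincipalValue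
        (fun ξ : ℝ => legendreP (-(n : ℂ) - 1) ξ ^ 2 / (2 * ((x : ℂ) - (ξ : ℂ))))
        (-1) 1 x (legendreP (n : ℂ) x * legendreQNat n x)) := by
  refine ⟨fun ν hν x h1 h2 => hasPrincipalValue_legendreP_mul_legendreP_neg hν ⟨h1, h2⟩,
    fun n x h1 h2 => ⟨tendsto_legendreQ_legendreQNat n ⟨h1, h2⟩,
      hasPrincipalValue_legendreP_sq n ⟨h1, h2⟩, ?_⟩⟩
  simp_rw [legendreP_neg_sub_one]
  exact hasPrincipalValue_legendreP_sq n ⟨h1, h2⟩
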